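/- Consider an episodic MDP with finite nonempty state space $\mathcal S$ and action space $\mathcal A$, $S=|\mathcal S|$, $A=|\mathcal A|$, horizon $H\ge 1$, transition kernels $P_h(\cdot\mid s,a)$ and deterministic rewards $r_h:\mathcal S\times\mathcal A\to[0,1]$, $h\in[H]$. Fix a risk parameter $\beta\neq0$ (of either sign), a number of episodes $K\ge1$ and $\delta\in(0,1]$, and put $T=KH$. For a policy $\pi=(\pi_h)_{h\in[H]}$, $\pi_h:\mathcal S\to\mathcal A$, let $$V_1^{\pi}(s)=\frac1\beta\log\mathbb E\Big[\exp\Big(\beta\sum_{h=1}^H r_h(s_h,\pi_h(s_h))\Big)\,\Big|\,s_1=s\Big],\qquad V_1^*(s)=\sup_\pi V_1^\pi(s),$$ where $s_{h+1}\sim P_h(\cdot\mid s_h,\pi_h(s_h))$. The RSVI algorithm with bonus constant $c_\gamma>0$ proceeds as follows. At the start of episode $k\in[K]$, let $(s_h^\tau,a_h^\tau,s_{h+1}^\tau)$, $\tau\in[k-1]$, be the transitions observed at step $h$ in the previous episodes, and let $N_h(s,a)=\#\{\tau\in[k-1]:(s_h^\tau,a_h^\tau)=(s,a)\}$. Set $V_{H+1}\equiv0$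 and, for $h=H,\dots,1$, take $$w_h\in\operatorname*{arg\,min}_{w\in\mathbb R^{\mathcal S\times\mathcal A}}\sum_{\tau\in[k-1]}\Big[e^{\beta[r_h(s_h^\tau,a_h^\tau)+V_{h+1}(s_{h+1}^\tau)]}-w(s_h^\tau,a_h^\tau)\Big]^2 ,$$ and for every $(s,a)$ with $N_h(s,a)\ge1$ set $b_h(s,a)=c_\gamma\,|e^{\beta H}-1|\sqrt{S\log(2SAT/\delta)/N_h(s,a)}$ and $$Q_h(s,a)=\begin{cases}\frac1\beta\log\min\{e^{\beta(H-h+1)},\,w_h(s,a)+b_h(s,a)\},&\beta>0,\\[2pt] \frac1\beta\log\max\{e^{\beta(H-h+1)},\,w_h(s,a)-b_h(s,a)\},&\beta<0,\end{cases}$$ while $Q_h(s,a)=H-h+1$ if $N_h(s,a)=0$; then set $V_h(s)=\max_{a}Q_h(s,a)$. In episode $k$ the environment chooses the initial state $s_1^k$ arbitrarily (possibly depending on the past), and the agent executes the greedy policy $\pi^k_h(s)\in\operatorname{arg\,max}_a Q_h(s,a)$, ties being broken arbitrarily. The regret is $\mathrm{Regret}(K)=\sum_{k=1}^K\big[V_1^*(s_1^k)-V_1^{\pi^k}(s_1^k)\big]$.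 **Theorem.** There are universal constants $c_\gamma>0$ and $C>0$ such that, for all $\mathcal S,\mathcal A,H,K,(P_h),(r_h),\beta\ne0$, all $\delta\in(0,1]$ and every choice of initial states and tie-breaking as above, RSVI run with bonus constant $c_\gamma$ satisfies, with probability at least $1-\delta$, $$\mathrm{Regret}(K)\le C\,\lambda(|\beta|H^2)\,\sqrt{H^3S^2A\,T\,\log^2(2SAT/\delta)},\qquad \lambda(u)=\frac{e^{3u}-1}{u}.$$ -/

import Mathlib

open scoped BigOperators

namespace RiskRL

noncomputable section

/-- An episodic Markov decision process with `H` steps per episode, indexed by `Fin H` (so the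
step called `h` in one-based notation has index `h - 1`): transition kernels and deterministic
rewards with values in `[0, 1]`. -/
structure MDP (S : Type*) (A : Type*) (H : ℕ) where
  /-- `trans h s a` is the law of the next state. -/
  trans : Fin H → S → A → PMF S
  /-- `reward h s a` is the reward. -/
  reward : Fin H → S → A → ℝ
  reward_mem : ∀ h s a, reward h s a ∈ Set.Icc (0 : ℝ) 1

/-- A (deterministic, step-dependent) policy. -/
abbrev Policy (S : Type*) (A : Type*) (H : ℕ) := Fin H → S → A

/-- The states `s_1, …, s_{H+1}` visited during an episode. -/
abbrev Path (S : Type*) (H : ℕ) := Fin (H + 1) → S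

/-- The law of the path generated from the initial state `s` when the policy `π` is executed
against the transition kernels `P`. -/
def pathLaw {S : Type*} {A : Type*} : {H : ℕ} → (Fin H → S → A → PMF S) → Policy S A H →
    S → PMF (Path S H)
  | 0, _, _, s => PMF.pure (fun _ => s)
  | _ + 1, P, π, s => (P 0 s (π 0 s)).bind fun s' =>
      (pathLaw (fun h => P h.succ) (fun h => π h.succ) s').map fun x => Fin.cons s x

/-- The total reward collected along the path `x` under the policy `π`. -/
def totalReward {S : Type*} {A : Type*} {H : ℕ} (M : MDP S A H) (π : Policy S A H)
    (x : Path S H) : ℝ :=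
  ∑ h : Fin H, M.reward h (x h.castSucc) (π h (x h.castSucc))

/-- The value function at the first step,
`V_1^π(s) = (1/β) log E[exp(β ∑_h r_h(s_h, π_h(s_h))) | s_1 = s]`. -/
def value {S : Type*} {A : Type*} {H : ℕ} [Fintype S] (M : MDP S A H) (β : ℝ)
    (π : Policy S A H) (s : S) : ℝ :=
  1 / β * Real.log (∑ x : Path S H,
    (pathLaw M.trans π s x).toReal * Real.exp (β * totalReward M π x))

/-- The optimal value function at the first step, `V_1^*(s) = sup_π V_1^π(s)`. The supremum is
over the finitely many policies. -/
def optValue {S : Type*} {A : Type*} {H : ℕ} [Fintype S] (M : MDP S A H) (β : ℝ) (s : S) : ℝ :=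
  ⨆ π : Policy S A H, value M β π s

/-- The record of one episode: the policy that was executed and the path that was observed. -/
abbrev Episode (S : Type*) (A : Type*) (H : ℕ) := Policy S A H × Path S H

/-- The state `s_h` of an episode. -/
def Episode.state {S : Type*} {A : Type*} {H : ℕ} (e : Episode S A H) (h : Fin H) : S :=
  e.2 h.castSucc

/-- The action `a_h = π_h(s_h)` of an episode. -/
def Episode.action {S : Type*} {A : Type*} {H : ℕ} (e : Episode S A H) (h : Fin H) : A :=
  e.1 h (e.state h)

/-- The state `s_{h+1}` of an episode. -/
def Episode.next {S : Type*} {A : Type*} {H : ℕ} (e : Episode S A H) (h : Fin H) : S :=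
  e.2 h.succ

/-- The first `k` episodes. -/
abbrev History (S : Type*) (A : Type*) (H : ℕ) (k : ℕ) := Fin k → Episode S A H

section Algorithm

variable {S : Type*} {A : Type*} {H k : ℕ}

/-- The canonical basis vectors of `ℝ^{SA}`. -/
def feature (s : S) (a : A) : S × A → ℝ :=
  open Classical in Pi.single (s, a) 1

/-- The number `N_h(s, a)` of past visits of the pair `(s, a)` at step `h`. -/
def visits (D : History S A H k) (h : Fin H) (s : S) (a : A) : ℕ :=
  open Classical in
    (Finset.univ.filter fun τ : Fin k => (D τ).state h = s ∧ (D τ).action h = a).card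

/-- The least-squares objective at step `h`, where `Vnext` is the current estimate `V_{h+1}`. -/
def lsLoss [Fintype S] [Fintype A] (r : Fin H → S → A → ℝ) (β : ℝ) (D : History S A H k)
    (h : Fin H) (Vnext : S → ℝ) (w : S × A → ℝ) : ℝ :=
  ∑ τ : Fin k, (Real.exp (β * (r h ((D τ).state h) ((D τ).action h) + Vnext ((D τ).next h)))
    - w ⬝ᵥ feature ((D τ).state h) ((D τ).action h)) ^ 2

/-- The least-squares objective has a minimizer. -/
theorem exists_isMinOn_lsLoss [Fintype S] [Fintype A] (r : Fin H → S → A → ℝ) (β : ℝ)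
    (D : History S A H k) (h : Fin H) (Vnext : S → ℝ) :
    ∃ w, IsMinOn (lsLoss r β D h Vnext) Set.univ w := by
  classical
  set y : Fin k → ℝ := fun τ =>
    Real.exp (β * (r h ((D τ).state h) ((D τ).action h) + Vnext ((D τ).next h))) with hy
  set p : Fin k → S × A := fun τ => ((D τ).state h, (D τ).action h) with hp
  have hloss : ∀ w, lsLoss r β D h Vnext w =
      ∑ q : S × A, ∑ τ ∈ Finset.univ.filter (fun τ => p τ = q), (y τ - w q) ^ 2 := by
    intro w
    have h1 : lsLoss r β D h Vnext w = ∑ τ, (y τ - w (p τ)) ^ 2 := by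
      simp [lsLoss, feature, hy, hp]
    rw [h1, ← Finset.sum_fiberwise Finset.univ p]
    refine Finset.sum_congr rfl fun q _ => Finset.sum_congr rfl fun τ hτ => ?_
    rw [(Finset.mem_filter.1 hτ).2]
  refine ⟨fun q => (∑ τ ∈ Finset.univ.filter (fun τ => p τ = q), y τ) /
    ((Finset.univ.filter (fun τ => p τ = q)).card : ℝ), fun w _ => ?_⟩
  simp only [Set.mem_ofPred_eq, hloss]
  refine Finset.sum_le_sum fun q _ => ?_
  set F := Finset.univ.filter (fun τ => p τ = q)
  rcases F.eq_empty_or_nonempty with h0 | h0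
  · simp [h0]
  have hc : (0 : ℝ) < (F.card : ℝ) := by exact_mod_cast h0.card_pos
  set m : ℝ := (∑ τ ∈ F, y τ) / (F.card : ℝ) with hm
  have hsum : ∑ τ ∈ F, y τ = (F.card : ℝ) * m := by rw [hm]; field_simp
  have key : ∑ τ ∈ F, (y τ - w q) ^ 2 =
      ∑ τ ∈ F, (y τ - m) ^ 2 + (F.card : ℝ) * (m - w q) ^ 2 := by
    have h2 : ∀ τ ∈ F, (y τ - w q) ^ 2 =
        (y τ - m) ^ 2 + (2 * (m - w q) * y τ + (w q ^ 2 - m ^ 2)) := fun τ _ => by ring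
    rw [Finset.sum_congr rfl h2, Finset.sum_add_distrib, Finset.sum_add_distrib,
      ← Finset.mul_sum, hsum, Finset.sum_const, nsmul_eq_mul]
    ring
  rw [key]
  have := mul_nonneg hc.le (sq_nonneg (m - w q))
  linarith

/-- The least-squares weight `w_h`. Minimizers differ at most at pairs that were never visited,
and the algorithm does not use the weight there. -/
def lsWeight [Fintype S] [Fintype A] (r : Fin H → S → A → ℝ) (β : ℝ) (D : History S A H k)
    (h : Fin H) (Vnext : S → ℝ) : S × A → ℝ :=
  Classical.choose (exists_isMinOn_lsLoss r β D h Vnext)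

/-- The bonus `b_h(s, a) = c |e^{βH} - 1| √(S log(2SAT/δ) / N_h(s, a))` with `T = KH`. -/
def bonus [Fintype S] [Fintype A] (c β δ : ℝ) (K : ℕ) (D : History S A H k)
    (h : Fin H) (s : S) (a : A) : ℝ :=
  c * |Real.exp (β * H) - 1| *
    Real.sqrt ((Fintype.card S : ℝ) *
      Real.log (2 * Fintype.card S * Fintype.card A * (K * H : ℝ) / δ) / (visits D h s a : ℝ))

/-- The update of `Q_h` from the current estimate `Vnext` of `V_{h+1}`. A pair that was never
visited keeps its initial value, the number of remaining steps (`H - h + 1` in one-based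
notation). -/
def qUpdate [Fintype S] [Fintype A] (r : Fin H → S → A → ℝ) (c β δ : ℝ) (K : ℕ)
    (D : History S A H k) (h : Fin H) (Vnext : S → ℝ) (s : S) (a : A) : ℝ :=
  if visits D h s a = 0 then (H : ℝ) - (h : ℕ)
  else if 0 < β then
    1 / β * Real.log (min (Real.exp (β * ((H : ℝ) - (h : ℕ))))
      (lsWeight r β D h Vnext (s, a) + bonus c β δ K D h s a))
  else
    1 / β * Real.log (max (Real.exp (β * ((H : ℝ) - (h : ℕ))))
      (lsWeight r β D h Vnext (s, a) - bonus c β δ K D h s a))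

/-- The value estimates of the algorithm after the `k` episodes recorded in `D`, computed
backwards from `V_{H+1} = 0` by `V_h(s) = max_a Q_h(s, a)`. -/
def estV [Fintype S] [Fintype A] [Nonempty A] (r : Fin H → S → A → ℝ) (c β δ : ℝ) (K : ℕ)
    (D : History S A H k) : Fin (H + 1) → S → ℝ :=
  Fin.reverseInduction (motive := fun _ => S → ℝ) (fun _ => 0)
    (fun h Vnext s => Finset.univ.sup' Finset.univ_nonempty (qUpdate r c β δ K D h Vnext s))

/-- The action-value estimates of the algorithm after the `k` episodes recorded in `D`. -/
def estQ [Fintype S] [Fintype A] [Nonempty A] (r : Fin H → S → A → ℝ) (c β δ : ℝ) (K : ℕ)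
    (D : History S A H k) (h : Fin H) : S → A → ℝ :=
  qUpdate r c β δ K D h (estV r c β δ K D h.succ)

/-- `π` is a policy that the algorithm may execute in the episode that follows `D`: each action
maximizes the action-value estimate. -/
def IsGreedy [Fintype S] [Fintype A] [Nonempty A] (r : Fin H → S → A → ℝ) (c β δ : ℝ) (K : ℕ)
    (D : History S A H k) (π : Policy S A H) : Prop :=
  ∀ h s a, estQ r c β δ K D h s a ≤ estQ r c β δ K D h s (π h s)

end Algorithm

/-- A rule that picks the initial state and the policy of the next episode from the past, possibly
at random. The first component is the environment's choice of the initial state, the second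
one is the agent's policy. -/
abbrev Rule (S : Type*) (A : Type*) (H : ℕ) := (k : ℕ) → History S A H k → PMF (S × Policy S A H)

/-- `ρ` is an execution of the algorithm: the initial states are arbitrary, and
the policies are greedy for the current estimates, with ties broken arbitrarily. -/
def IsRSVI {S : Type*} {A : Type*} {H : ℕ} [Fintype S] [Fintype A] [Nonempty A]
    (r : Fin H → S → A → ℝ) (c β δ : ℝ) (K : ℕ) (ρ : Rule S A H) : Prop :=
  ∀ k < K, ∀ (D : History S A H k), ∀ q ∈ (ρ k D).support, IsGreedy r c β δ K D q.2

/-- The law of the first `k` episodes when initial states and policies are picked by `ρ` and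
paths are generated by the MDP. -/
def runLaw {S : Type*} {A : Type*} {H : ℕ} (M : MDP S A H) (ρ : Rule S A H) :
    (k : ℕ) → PMF (History S A H k)
  | 0 => PMF.pure Fin.elim0
  | k + 1 => (runLaw M ρ k).bind fun D => (ρ k D).bind fun q =>
      (pathLaw M.trans q.2 q.1).map fun x => Fin.snoc (α := fun _ => Episode S A H) D (q.2, x)

/-- `Regret(K) = ∑_k [V_1^*(s_1^k) - V_1^{π^k}(s_1^k)]`. -/
def regret {S : Type*} {A : Type*} {H K : ℕ} [Fintype S] (M : MDP S A H) (β : ℝ)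
    (D : History S A H K) : ℝ :=
  ∑ k : Fin K, (optValue M β ((D k).2 0) - value M β (D k).1 ((D k).2 0))

/-- `λ(u) = (e^{3u} - 1) / u`. -/
def expFactor (u : ℝ) : ℝ := (Real.exp (3 * u) - 1) / u

end

end RiskRL

/-! After exponentiation the Bellman recursion is linear, and multiplying by the sign `σ` of `β`
makes `x ↦ σ * exp (β * x)` increasing, so one optimism argument serves both signs.

The value estimates depend on the same data as the empirical means, so concentration must be uniform
over functions. Controlling the indicators of all subsets of states is enough: a deviation is linear
in the function, hence over functions with values in `[0, R]` it is largest at `R` times an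
indicator (`deviation_le_of_nonneg`). The union over `2 ^ S` subsets costs the `√S` in the bonus. On
this event the bonus dominates the backup error (`abs_mul_lsWeight_sub_le`), the estimates are
optimistic (`mul_expValue_le`), and their gap to the greedy policy's value grows by at most `exp
|β|` per step, with a source of order `1 / √(N + 1)` (`estimation_error_step`).

Unrolling costs `exp (|β| H)`, taking logarithms costs `exp (|β| H) / |β|`, and the bonus
contributes `|exp (β H) - 1| ≤ exp (|β| H) - 1`. The product is at most `(exp (3 |β| H) - 1) / |β|`,
which Bernoulli's inequality bounds by `H * λ(|β| H²)`. What remains is the expected sum of `1 / √(N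
+ 1)` along each executed policy. An Azuma argument replaces expected by observed sums up to `H √(2
K ι)`, where `ι` is the logarithm in the bonus, and a pigeonhole count bounds the latter by `2 H √(S
A K)`. Both failure events are detected by exponential weights of small mean, so Markov's inequality
concludes. -/

namespace RiskRL

/-! ### Expectations under finitely supported laws, Markov and Hoeffding bounds. -/

section Expectation

/-- The expectation of a real function under a probability mass function. -/
noncomputable def expect {α : Type*} (p : PMF α) (f : α → ℝ) : ℝ := ∑' x, (p x).toReal * f x

variable {α β : Type*}

theorem expect_eq_sum [Fintype α] (p : PMF α) (f : α → ℝ) :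
    expect p f = ∑ x, (p x).toReal * f x := tsum_fintype _

theorem sum_toReal [Fintype α] (p : PMF α) : ∑ x, (p x).toReal = 1 := by
  rw [← ENNReal.toReal_sum (fun x _ => p.apply_ne_top x), ← tsum_fintype (L := .unconditional _),
    p.tsum_coe, ENNReal.toReal_one]

theorem expect_const [Finite α] (p : PMF α) (c : ℝ) : expect p (fun _ => c) = c := by
  have := Fintype.ofFinite α
  rw [expect_eq_sum, ← Finset.sum_mul, sum_toReal, one_mul]

theorem expect_pure [Finite α] (a : α) (f : α → ℝ) : expect (PMF.pure a) f = f a := by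
  classical
  have := Fintype.ofFinite α
  rw [expect_eq_sum, Finset.sum_eq_single a]
  · simp
  · intro b _ hb
    simp [PMF.pure_apply, hb]
  · simp

theorem expect_bind [Finite α] [Finite β] (p : PMF α) (q : α → PMF β) (f : β → ℝ) :
    expect (p.bind q) f = expect p fun a => expect (q a) f := by
  have := Fintype.ofFinite α
  have := Fintype.ofFinite β
  simp only [expect_eq_sum, PMF.bind_apply, tsum_fintype]
  have h : ∀ b, (∑ a, p a * q a b).toReal = ∑ a, (p a).toReal * (q a b).toReal := by
    intro b
    rw [ENNReal.toReal_sum fun a _ => ENNReal.mul_ne_top (p.apply_ne_top a) ((q a).apply_ne_top b)]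
    simp
  simp only [h, Finset.sum_mul, Finset.mul_sum]
  rw [Finset.sum_comm]
  simp only [mul_assoc]

theorem expect_map [Finite α] [Finite β] (p : PMF α) (g : α → β) (f : β → ℝ) :
    expect (p.map g) f = expect p fun a => f (g a) := by
  rw [PMF.map, expect_bind]
  simp [expect_pure]

theorem expect_mono [Finite α] (p : PMF α) {f g : α → ℝ} (h : ∀ x ∈ p.support, f x ≤ g x) :
    expect p f ≤ expect p g := by
  have := Fintype.ofFinite α
  rw [expect_eq_sum, expect_eq_sum]
  refine Finset.sum_le_sum fun x _ => ?_
  by_cases hx : x ∈ p.support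
  · exact mul_le_mul_of_nonneg_left (h x hx) ENNReal.toReal_nonneg
  · simp [(p.apply_eq_zero_iff x).2 hx]

theorem expect_congr [Finite α] (p : PMF α) {f g : α → ℝ} (h : ∀ x ∈ p.support, f x = g x) :
    expect p f = expect p g :=
  le_antisymm (expect_mono p fun x hx => (h x hx).le) (expect_mono p fun x hx => (h x hx).ge)

theorem expect_add [Finite α] (p : PMF α) (f g : α → ℝ) :
    expect p (fun x => f x + g x) = expect p f + expect p g := by
  have := Fintype.ofFinite α
  simp only [expect_eq_sum, mul_add, Finset.sum_add_distrib]

theorem expect_sub [Finite α] (p : PMF α) (f g : α → ℝ) :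
    expect p (fun x => f x - g x) = expect p f - expect p g := by
  have := Fintype.ofFinite α
  simp only [expect_eq_sum, mul_sub, Finset.sum_sub_distrib]

theorem expect_const_mul [Finite α] (p : PMF α) (c : ℝ) (f : α → ℝ) :
    expect p (fun x => c * f x) = c * expect p f := by
  have := Fintype.ofFinite α
  simp only [expect_eq_sum, Finset.mul_sum]
  exact Finset.sum_congr rfl fun _ _ => by ring

theorem expect_finset_sum [Finite α] {ι : Type*} (p : PMF α) (t : Finset ι) (f : ι → α → ℝ) :
    expect p (fun x => ∑ i ∈ t, f i x) = ∑ i ∈ t, expect p (f i) := by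
  have := Fintype.ofFinite α
  simp only [expect_eq_sum, Finset.mul_sum]
  exact Finset.sum_comm

theorem expect_nonneg [Finite α] (p : PMF α) {f : α → ℝ} (h : ∀ x, 0 ≤ f x) : 0 ≤ expect p f := by
  simpa [expect_const] using expect_mono p (f := fun _ => 0) (g := f) fun x _ => h x

theorem expect_le [Finite α] (p : PMF α) {f : α → ℝ} {c : ℝ} (h : ∀ x ∈ p.support, f x ≤ c) :
    expect p f ≤ c := by
  simpa [expect_const] using expect_mono p (f := f) (g := fun _ => c) h

theorem le_expect [Finite α] (p : PMF α) {f : α → ℝ} {c : ℝ} (h : ∀ x ∈ p.support, c ≤ f x) :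
    c ≤ expect p f := by
  simpa [expect_const] using expect_mono p (f := fun _ => c) (g := f) h

/-- Markov's inequality in the form of a lower bound for the probability of a good event. -/
theorem ofReal_one_sub_le_toOuterMeasure [Finite α] (p : PMF α) {s : Set α} {f : α → ℝ} {δ : ℝ}
    (hf : ∀ x, 0 ≤ f x) (hs : ∀ x ∈ p.support, x ∉ s → 1 ≤ f x) (hδ : expect p f ≤ δ) :
    ENNReal.ofReal (1 - δ) ≤ p.toOuterMeasure s := by
  classical
  have := Fintype.ofFinite α
  rw [PMF.toOuterMeasure_apply_fintype]
  have hne : ∀ x ∈ Finset.univ, s.indicator (⇑p) x ≠ ⊤ := fun x _ => by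
    by_cases hx : x ∈ s <;> simp [hx, p.apply_ne_top]
  refine ENNReal.ofReal_le_of_le_toReal ?_
  rw [ENNReal.toReal_sum hne]
  have h1 : expect p (fun x => 1 - f x) ≤ ∑ x, (s.indicator (⇑p) x).toReal := by
    rw [expect_eq_sum]
    refine Finset.sum_le_sum fun x _ => ?_
    have hp : 0 ≤ (p x).toReal := ENNReal.toReal_nonneg
    by_cases hx : x ∈ s
    · simp only [hx, Set.indicator_of_mem]
      nlinarith [hf x]
    · simp only [hx, not_false_eq_true, Set.indicator_of_notMem, ENNReal.toReal_zero]
      by_cases hx' : x ∈ p.support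
      · nlinarith [hs x hx' hx]
      · simp [(p.apply_eq_zero_iff x).2 hx']
  rw [expect_sub, expect_const] at h1
  linarith

/-- Hoeffding's lemma for a centred bounded variable. -/
theorem expect_exp_le_of_abs_le [Finite α] (p : PMF α) {f : α → ℝ} {R : ℝ} (hR : 0 < R)
    (h0 : expect p f = 0) (hf : ∀ x ∈ p.support, |f x| ≤ R) (l : ℝ) :
    expect p (fun x => Real.exp (l * f x)) ≤ Real.exp ((l * R) ^ 2 / 2) := by
  -- By convexity the exponential lies below its chord on `[-R, R]`; the linear part has mean zero.
  have h1 : expect p (fun x => Real.exp (l * f x)) ≤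
      expect p (fun x => Real.cosh (l * R) + Real.sinh (l * R) / R * f x) := by
    refine expect_mono p fun x hx => ?_
    have h2 : |f x / R| ≤ 1 := by
      rw [abs_div, abs_of_pos hR, div_le_one hR]
      exact hf x hx
    have h3 := Real.exp_mul_le_cosh_add_mul_sinh h2 (l * R)
    have e1 : f x / R * (l * R) = l * f x := by field_simp
    have e2 : f x / R * Real.sinh (l * R) = Real.sinh (l * R) / R * f x := by ring
    rwa [e1, e2] at h3
  rw [expect_add, expect_const, expect_const_mul, h0, mul_zero, add_zero] at h1
  exact h1.trans (Real.cosh_le_exp_half_sq _)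

end Expectation

/-! ### Recursions along a single episode. -/

section PathLaw

variable {S A : Type*} {H : ℕ}

theorem apply_zero_of_mem_support_pathLaw {P : Fin H → S → A → PMF S} {π : Policy S A H} {s : S}
    {x : Path S H} (hx : x ∈ (pathLaw P π s).support) : x 0 = s := by
  cases H with
  | zero =>
    rw [pathLaw, PMF.support_pure, Set.mem_singleton_iff] at hx
    rw [hx]
  | succ H =>
    rw [pathLaw, PMF.mem_support_bind_iff] at hx
    obtain ⟨s', _, h⟩ := hx
    rw [PMF.mem_support_map_iff] at h
    obtain ⟨y, _, rfl⟩ := h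
    rfl

variable [Finite S]

theorem expect_pathLaw_zero (P : Fin 0 → S → A → PMF S) (π : Policy S A 0) (s : S)
    (F : Path S 0 → ℝ) : expect (pathLaw P π s) F = F fun _ => s := by
  rw [pathLaw, expect_pure]

theorem expect_pathLaw_succ (P : Fin (H + 1) → S → A → PMF S) (π : Policy S A (H + 1)) (s : S)
    (F : Path S (H + 1) → ℝ) :
    expect (pathLaw P π s) F = expect (P 0 s (π 0 s)) fun s' =>
      expect (pathLaw (fun h => P h.succ) (fun h => π h.succ) s') fun x => F (Fin.cons s x) := by
  rw [pathLaw, expect_bind]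
  simp only [expect_map]

/-- The one-step bound holds from every state, so the law of the state reached at step `h` does not
matter. -/
theorem expect_pathLaw_step_le {c : ℝ} (P : Fin H → S → A → PMF S) (π : Policy S A H)
    (h : Fin H) (g : S → S → ℝ) (hg : ∀ s, expect (P h s (π h s)) (g s) ≤ c) (s : S) :
    expect (pathLaw P π s) (fun x => g (x h.castSucc) (x h.succ)) ≤ c := by
  induction H generalizing s with
  | zero => exact h.elim0
  | succ H ih =>
    rw [expect_pathLaw_succ]
    induction h using Fin.cases with
    | zero =>
      refine le_trans (le_of_eq (expect_congr _ fun s' _ => ?_)) (hg s)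
      rw [← expect_const (pathLaw (fun h => P h.succ) (fun h => π h.succ) s') (g s s')]
      refine expect_congr _ fun x hx => ?_
      rw [← apply_zero_of_mem_support_pathLaw hx]
      rfl
    | succ h =>
      refine expect_le _ fun s' _ => ?_
      exact ih (fun h => P h.succ) (fun h => π h.succ) h hg s'

/-- A Bellman recursion computes the exponential moment of the total reward. -/
theorem expect_pathLaw_exp_sum (β : ℝ) (P : Fin H → S → A → PMF S) (π : Policy S A H)
    (r : Fin H → S → A → ℝ) (U : Fin (H + 1) → S → ℝ) (hlast : ∀ s, U (Fin.last H) s = 1)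
    (hU : ∀ h s, U h.castSucc s =
      Real.exp (β * r h s (π h s)) * expect (P h s (π h s)) (U h.succ)) (s : S) :
    expect (pathLaw P π s)
      (fun x => Real.exp (β * ∑ h : Fin H, r h (x h.castSucc) (π h (x h.castSucc)))) = U 0 s := by
  induction H generalizing s with
  | zero =>
    rw [expect_pathLaw_zero]
    simpa using (hlast s).symm
  | succ H ih =>
    rw [expect_pathLaw_succ]
    have h0 := hU 0 s
    rw [Fin.castSucc_zero] at h0
    rw [h0, ← expect_const_mul]
    refine expect_congr _ fun s' _ => ?_
    rw [← ih (fun h => P h.succ) (fun h => π h.succ) (fun h => r h.succ) (fun h => U h.succ)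
      hlast (fun h s => hU h.succ s) s', ← expect_const_mul]
    refine expect_congr _ fun x _ => ?_
    rw [Fin.sum_univ_succ, mul_add, Real.exp_add]
    rfl

/-- Unrolling a Bellman-type inequality along the path. -/
theorem le_pow_mul_expect_pathLaw {F : ℝ} (hF : 1 ≤ F) (P : Fin H → S → A → PMF S)
    (π : Policy S A H) (g : Fin H → S → ℝ) (hg : ∀ h s, 0 ≤ g h s) (X : Fin (H + 1) → S → ℝ)
    (hlast : ∀ s, X (Fin.last H) s ≤ 0)
    (hX : ∀ h s, X h.castSucc s ≤ g h s + F * expect (P h s (π h s)) (X h.succ)) (s : S) :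
    X 0 s ≤ F ^ H * expect (pathLaw P π s) (fun x => ∑ h : Fin H, g h (x h.castSucc)) := by
  induction H generalizing s with
  | zero =>
    rw [expect_pathLaw_zero]
    simpa using hlast s
  | succ H ih =>
    have ih' := ih (fun h => P h.succ) (fun h => π h.succ) (fun h => g h.succ)
      (fun h s => hg h.succ s) (fun h => X h.succ) hlast (fun h s => hX h.succ s)
    have h0 := hX 0 s
    rw [Fin.castSucc_zero] at h0
    have h1 : expect (P 0 s (π 0 s)) (X (Fin.succ 0)) ≤ expect (P 0 s (π 0 s)) fun s' => F ^ H *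
        expect (pathLaw (fun h => P h.succ) (fun h => π h.succ) s')
          (fun x => ∑ h : Fin H, g h.succ (x h.castSucc)) := expect_mono _ fun s' _ => ih' s'
    rw [expect_const_mul] at h1
    have h2 : expect (pathLaw P π s) (fun x => ∑ h : Fin (H + 1), g h (x h.castSucc)) =
        g 0 s + expect (P 0 s (π 0 s)) fun s' =>
        expect (pathLaw (fun h => P h.succ) (fun h => π h.succ) s')
          (fun x => ∑ h : Fin H, g h.succ (x h.castSucc)) := by
      rw [expect_pathLaw_succ, ← expect_const (P 0 s (π 0 s)) (g 0 s), ← expect_add]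
      refine expect_congr _ fun s' _ => ?_
      rw [← expect_const (pathLaw (fun h => P h.succ) (fun h => π h.succ) s') (g 0 s),
        ← expect_add]
      refine expect_congr _ fun x _ => ?_
      rw [Fin.sum_univ_succ]
      rfl
    rw [h2, mul_add, pow_succ']
    -- Every source term is charged the full power of `F`, whatever its step; `1 ≤ F` makes this
    -- legitimate.
    have h3 : g 0 s ≤ F * F ^ H * g 0 s := by
      rw [← pow_succ']
      exact le_mul_of_one_le_left (hg 0 s) (one_le_pow₀ hF)
    have h4 := mul_le_mul_of_nonneg_left h1 (zero_le_one.trans hF)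
    linarith

end PathLaw

/-! ### Supermartingales over the sequence of episodes. -/

section RunLaw

variable {S A : Type*} {H : ℕ}

theorem forall_mem_support_runLaw {M : MDP S A H} {ρ : Rule S A H} {K : ℕ}
    (p : ∀ k, History S A H k → Prop) (h0 : p 0 Fin.elim0)
    (hstep : ∀ k < K, ∀ D, p k D → ∀ q ∈ (ρ k D).support, ∀ x : Path S H,
      p (k + 1) (Fin.snoc (α := fun _ => Episode S A H) D (q.2, x)))
    {k : ℕ} (hk : k ≤ K) {D : History S A H k} (hD : D ∈ (runLaw M ρ k).support) : p k D := by
  induction k with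
  | zero => rwa [Subsingleton.elim D Fin.elim0]
  | succ k ih =>
    rw [runLaw, PMF.mem_support_bind_iff] at hD
    obtain ⟨D', hD', h⟩ := hD
    rw [PMF.mem_support_bind_iff] at h
    obtain ⟨q, hq, h⟩ := h
    rw [PMF.mem_support_map_iff] at h
    obtain ⟨x, _, rfl⟩ := h
    exact hstep k hk D' (ih (Nat.le_of_succ_le hk) hD') q hq x

/-- The first `k` of `K` episodes. -/
def past {K : ℕ} (D : History S A H K) {k : ℕ} (hk : k ≤ K) : History S A H k :=
  fun i => D (Fin.castLE hk i)

theorem past_self {K : ℕ} (D : History S A H K) : past D le_rfl = D := rfl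

theorem past_snoc {K : ℕ} (D : History S A H K) (e : Episode S A H) {k : ℕ} (hk : k ≤ K) :
    past (Fin.snoc (α := fun _ => Episode S A H) D e : History S A H (K + 1))
      (hk.trans K.le_succ) = past D hk := by
  funext i
  exact Fin.snoc_castSucc (α := fun _ => Episode S A H) e D (Fin.castLE hk i)

/-- The sum of per-episode quantities that may depend on the previous episodes. -/
noncomputable def cumulative (ψ : (k : ℕ) → History S A H k → Episode S A H → ℝ) {K : ℕ}
    (D : History S A H K) : ℝ :=
  ∑ k : Fin K, ψ k (past D k.2.le) (D k)

theorem cumulative_snoc (ψ : (k : ℕ) → History S A H k → Episode S A H → ℝ) {K : ℕ}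
    (D : History S A H K) (e : Episode S A H) :
    cumulative ψ (Fin.snoc (α := fun _ => Episode S A H) D e : History S A H (K + 1)) =
      cumulative ψ D + ψ K D e := by
  unfold cumulative
  rw [Fin.sum_univ_castSucc]
  congr 1
  · refine Finset.sum_congr rfl fun k _ => ?_
    rw [Fin.snoc_castSucc]
    exact congrArg (fun D' => ψ k D' (D k)) (past_snoc D e k.2.le)
  · rw [Fin.snoc_last]
    exact congrArg (fun D' => ψ K D' e) ((past_snoc D e le_rfl).trans (past_self D))

variable [Finite S] [Finite A]

theorem expect_runLaw_succ (M : MDP S A H) (ρ : Rule S A H) (k : ℕ)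
    (F : History S A H (k + 1) → ℝ) :
    expect (runLaw M ρ (k + 1)) F = expect (runLaw M ρ k) fun D => expect (ρ k D) fun q =>
      expect (pathLaw M.trans q.2 q.1) fun x =>
        F (Fin.snoc (α := fun _ => Episode S A H) D (q.2, x)) := by
  rw [runLaw, expect_bind]
  simp only [expect_bind, expect_map]

theorem expect_runLaw_past (M : MDP S A H) (ρ : Rule S A H) {k K : ℕ} (hk : k ≤ K)
    (F : History S A H k → ℝ) :
    expect (runLaw M ρ K) (fun D => F (past D hk)) = expect (runLaw M ρ k) F := by
  induction K, hk using Nat.le_induction with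
  | base => rfl
  | succ K hk ih =>
    rw [expect_runLaw_succ, ← ih]
    refine expect_congr _ fun D _ => ?_
    simp only [past_snoc _ _ hk, expect_const]

/-- The hypothesis covers every pair `q`, not only those that `ρ` selects; hence arbitrary initial
states and tie-breaking are harmless. -/
theorem expect_runLaw_le_of_supermartingale (M : MDP S A H) (ρ : Rule S A H)
    (W : (k : ℕ) → History S A H k → ℝ)
    (hW : ∀ k D (q : S × Policy S A H), expect (pathLaw M.trans q.2 q.1) (fun x =>
      W (k + 1) (Fin.snoc (α := fun _ => Episode S A H) D (q.2, x))) ≤ W k D) (k : ℕ) :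
    expect (runLaw M ρ k) (W k) ≤ W 0 Fin.elim0 := by
  induction k with
  | zero => rw [runLaw, expect_pure]
  | succ k ih =>
    rw [expect_runLaw_succ]
    exact (expect_mono _ fun D _ => expect_le _ fun q _ => hW k D q).trans ih

/-- If every increment has exponential moment at most one given the past, then so does the sum. -/
theorem expect_runLaw_exp_cumulative_le_one (M : MDP S A H) (ρ : Rule S A H)
    (ψ : (k : ℕ) → History S A H k → Episode S A H → ℝ)
    (hψ : ∀ k D (q : S × Policy S A H), expect (pathLaw M.trans q.2 q.1)
      (fun x => Real.exp (ψ k D (q.2, x))) ≤ 1) (k : ℕ) :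
    expect (runLaw M ρ k) (fun D => Real.exp (cumulative ψ D)) ≤ 1 := by
  refine (expect_runLaw_le_of_supermartingale M ρ (fun k D => Real.exp (cumulative ψ D))
    (fun k D q => ?_) k).trans (by simp [cumulative])
  simp only [cumulative_snoc, Real.exp_add]
  rw [expect_const_mul]
  exact mul_le_of_le_one_right (Real.exp_pos _).le (hψ k D q)

end RunLaw

/-! ### Uniform concentration of empirical transition frequencies. -/

section Concentration

variable {S A : Type*} {H k : ℕ}

open Classical in
/-- The indicator that an episode visits the pair `(s, a)` at step `h`. -/
noncomputable def visitInd (e : Episode S A H) (h : Fin H) (s : S) (a : A) : ℝ :=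
  if e.state h = s ∧ e.action h = a then 1 else 0

theorem visits_eq_sum (D : History S A H k) (h : Fin H) (s : S) (a : A) :
    (visits D h s a : ℝ) = ∑ τ, visitInd (D τ) h s a := by
  classical
  simp only [visits, visitInd, Finset.sum_boole]

theorem visits_snoc (D : History S A H k) (e : Episode S A H) (h : Fin H) (s : S) (a : A) :
    (visits (Fin.snoc (α := fun _ => Episode S A H) D e : History S A H (k + 1)) h s a : ℝ) =
      visits D h s a + visitInd e h s a := by
  simp only [visits_eq_sum, Fin.sum_univ_castSucc, Fin.snoc_castSucc, Fin.snoc_last]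

theorem visits_le (D : History S A H k) (h : Fin H) (s : S) (a : A) : visits D h s a ≤ k := by
  classical
  unfold visits
  exact (Finset.card_filter_le _ _).trans (by simp)

/-- The deviation of the unnormalized empirical mean of `f` at the successors of `(s, a)`. -/
noncomputable def deviation (M : MDP S A H) (D : History S A H k) (h : Fin H) (s : S) (a : A)
    (f : S → ℝ) : ℝ :=
  ∑ τ, visitInd (D τ) h s a * (f ((D τ).next h) - expect (M.trans h s a) f)

/-- The compensator `l ^ 2 / 2` is paid only in episodes that visit the pair, the others
contributing zero. The bound thus scales with the random count `N` rather than with `k`. -/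
theorem expect_exp_deviation_le_one [Finite S] [Finite A] (M : MDP S A H) (ρ : Rule S A H)
    (h : Fin H) (s : S) (a : A) {f : S → ℝ} (hf0 : ∀ s, 0 ≤ f s) (hf1 : ∀ s, f s ≤ 1) (l : ℝ)
    (k : ℕ) :
    expect (runLaw M ρ k) (fun D => Real.exp (l * deviation M D h s a f -
      l ^ 2 / 2 * visits D h s a)) ≤ 1 := by
  classical
  set m := expect (M.trans h s a) f with hm
  have h1 : ∀ D : History S A H k, l * deviation M D h s a f - l ^ 2 / 2 * visits D h s a =
      cumulative (fun _ _ e => visitInd e h s a * (l * (f (e.next h) - m) - l ^ 2 / 2)) D := by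
    intro D
    simp only [deviation, visits_eq_sum, cumulative, Finset.mul_sum, ← Finset.sum_sub_distrib]
    exact Finset.sum_congr rfl fun _ _ => by ring
  simp only [h1]
  refine expect_runLaw_exp_cumulative_le_one M ρ _ (fun k D q => ?_) k
  refine expect_pathLaw_step_le M.trans q.2 h (fun s₀ s₁ => Real.exp
    ((if s₀ = s ∧ q.2 h s₀ = a then 1 else 0) * (l * (f s₁ - m) - l ^ 2 / 2))) (fun s₀ => ?_) q.1
  by_cases hs : s₀ = s ∧ q.2 h s₀ = a
  · obtain ⟨rfl, rfl⟩ := hs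
    simp only [and_self, if_true, one_mul]
    have hm0 : 0 ≤ m := expect_nonneg _ hf0
    have hm1 : m ≤ 1 := expect_le _ fun s _ => hf1 s
    have h2 := expect_exp_le_of_abs_le (M.trans h s₀ (q.2 h s₀)) (f := fun s' => f s' - m) one_pos
      (by rw [expect_sub, expect_const, sub_self])
      (fun s' _ => abs_le.2 ⟨by linarith [hf0 s'], by linarith [hf1 s']⟩) l
    simp only [sub_eq_add_neg _ (l ^ 2 / 2), Real.exp_add, mul_comm _ (Real.exp (-(l ^ 2 / 2)))]
    rw [expect_const_mul]
    calc _ ≤ Real.exp (-(l ^ 2 / 2)) * Real.exp ((l * 1) ^ 2 / 2) :=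
          mul_le_mul_of_nonneg_left h2 (Real.exp_pos _).le
      _ = 1 := by rw [← Real.exp_add]; simp
  · simp [hs, expect_const]

/-- Azuma–Hoeffding in exponential form: given the past and the executed policy, each difference
between conditional mean and realization is centred and bounded by `R`. -/
theorem expect_exp_cumulative_sub_le_one [Finite S] [Finite A] (M : MDP S A H) (ρ : Rule S A H)
    (φ : (k : ℕ) → History S A H k → Episode S A H → ℝ) {R : ℝ} (hR : 0 < R)
    (h0 : ∀ k D e, 0 ≤ φ k D e) (h1 : ∀ k D e, φ k D e ≤ R) (l : ℝ) (k : ℕ) :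
    expect (runLaw M ρ k) (fun D => Real.exp (l * (cumulative (fun k D e =>
      expect (pathLaw M.trans e.1 (e.2 0)) fun x => φ k D (e.1, x)) D - cumulative φ D) -
        k * ((l * R) ^ 2 / 2))) ≤ 1 := by
  have h2 : ∀ D : History S A H k, l * (cumulative (fun k D e =>
      expect (pathLaw M.trans e.1 (e.2 0)) fun x => φ k D (e.1, x)) D - cumulative φ D) -
        k * ((l * R) ^ 2 / 2) =
      cumulative (fun k D e => l * (expect (pathLaw M.trans e.1 (e.2 0))
        (fun x => φ k D (e.1, x)) - φ k D e) - (l * R) ^ 2 / 2) D := by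
    intro D
    simp only [cumulative, Finset.sum_sub_distrib, ← Finset.mul_sum, Finset.sum_const,
      Finset.card_univ, Fintype.card_fin, nsmul_eq_mul]
  simp only [h2]
  refine expect_runLaw_exp_cumulative_le_one M ρ _ (fun k D q => ?_) k
  set m := expect (pathLaw M.trans q.2 q.1) (fun x => φ k D (q.2, x)) with hm
  have hm0 : 0 ≤ m := expect_nonneg _ fun _ => h0 _ _ _
  have hm1 : m ≤ R := expect_le _ fun _ _ => h1 _ _ _
  have h3 := expect_exp_le_of_abs_le (pathLaw M.trans q.2 q.1) (f := fun x => m - φ k D (q.2, x))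
    hR (by rw [expect_sub, expect_const, sub_self])
    (fun x _ => abs_le.2 ⟨by linarith [h1 k D (q.2, x)], by linarith [h0 k D (q.2, x)]⟩) l
  calc _ = expect (pathLaw M.trans q.2 q.1) (fun x =>
        Real.exp (-((l * R) ^ 2 / 2)) * Real.exp (l * (m - φ k D (q.2, x)))) := by
        refine expect_congr _ fun x hx => ?_
        dsimp only
        rw [← Real.exp_add, apply_zero_of_mem_support_pathLaw hx]
        congr 1
        ring
    _ ≤ Real.exp (-((l * R) ^ 2 / 2)) * Real.exp ((l * R) ^ 2 / 2) := by
        rw [expect_const_mul]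
        exact mul_le_mul_of_nonneg_left h3 (Real.exp_pos _).le
    _ = 1 := by rw [← Real.exp_add]; simp

/-- All deviations of indicators from their means are at most `x √N`. -/
def Concentrated (M : MDP S A H) (x : ℝ) (D : History S A H k) : Prop :=
  ∀ h s a (B : Finset S),
    deviation M D h s a ((B : Set S).indicator 1) ≤ x * Real.sqrt (visits D h s a)

theorem deviation_eq_zero (M : MDP S A H) {D : History S A H k} {h : Fin H} {s : S} {a : A}
    (h0 : visits D h s a = 0) (f : S → ℝ) : deviation M D h s a f = 0 := by
  classical
  refine Finset.sum_eq_zero fun τ _ => ?_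
  have : ¬((D τ).state h = s ∧ (D τ).action h = a) := by
    have := Finset.card_eq_zero.1 h0
    intro hτ
    exact Finset.notMem_empty τ (this ▸ Finset.mem_filter.2 ⟨Finset.mem_univ _, hτ⟩)
  simp [visitInd, this]

/-- The sum of the exponential weights that detect a failure of concentration within `K`
episodes. -/
noncomputable def concentrationWeight [Fintype S] [Fintype A] (M : MDP S A H) (x : ℝ) {K : ℕ}
    (D : History S A H K) : ℝ :=
  ∑ i : Fin K × Fin H × S × A × Finset S × Fin K,
    Real.exp (-(x ^ 2 / 2)) * Real.exp (x / Real.sqrt (i.2.2.2.2.2 + 1 : ℕ) *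
      deviation M (past D i.1.2.le) i.2.1 i.2.2.1 i.2.2.2.1 ((i.2.2.2.2.1 : Set S).indicator 1) -
      (x / Real.sqrt (i.2.2.2.2.2 + 1 : ℕ)) ^ 2 / 2 *
        visits (past D i.1.2.le) i.2.1 i.2.2.1 i.2.2.2.1)

variable [Fintype S] [Fintype A]

/-- The right tilt `x / √N` depends on a random count, so the weight has a term for each possible
`N`, indexed by `N - 1`. At the true `N` a violation makes the exponent at least `-x²/2 + x² - x²/2
= 0`. -/
theorem one_le_concentrationWeight (M : MDP S A H) {x : ℝ} (hx : 0 ≤ x) {K : ℕ}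
    {D : History S A H K} {k : Fin K} (hk : ¬Concentrated M x (past D k.2.le)) :
    1 ≤ concentrationWeight M x D := by
  unfold Concentrated at hk
  push Not at hk
  obtain ⟨h, s, a, B, hB⟩ := hk
  set N := visits (past D k.2.le) h s a with hN
  rcases Nat.eq_zero_or_pos N with h0 | h0
  · rw [deviation_eq_zero M h0, h0] at hB
    simp at hB
  have hNK : N - 1 < K := by
    have := visits_le (past D k.2.le) h s a
    have := k.2
    omega
  have hle := Finset.single_le_sum (s := Finset.univ)
    (f := fun i : Fin K × Fin H × S × A × Finset S × Fin K =>
    Real.exp (-(x ^ 2 / 2)) * Real.exp (x / Real.sqrt (i.2.2.2.2.2 + 1 : ℕ) *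
      deviation M (past D i.1.2.le) i.2.1 i.2.2.1 i.2.2.2.1 ((i.2.2.2.2.1 : Set S).indicator 1) -
      (x / Real.sqrt (i.2.2.2.2.2 + 1 : ℕ)) ^ 2 / 2 *
        visits (past D i.1.2.le) i.2.1 i.2.2.1 i.2.2.2.1))
    (fun i _ => by positivity) (Finset.mem_univ (k, h, s, a, B, ⟨N - 1, hNK⟩))
  refine le_trans ?_ hle
  simp only [Nat.sub_add_cancel h0, ← hN]
  rw [← Real.exp_add]
  refine Real.one_le_exp ?_
  have hs : 0 < Real.sqrt N := Real.sqrt_pos.2 (by exact_mod_cast h0)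
  have h1 : x / Real.sqrt N * (x * Real.sqrt N) ≤ x / Real.sqrt N *
      deviation M (past D k.2.le) h s a ((B : Set S).indicator 1) :=
    mul_le_mul_of_nonneg_left hB.le (by positivity)
  have h2 : x / Real.sqrt N * (x * Real.sqrt N) = x ^ 2 := by field_simp
  have h3 : (x / Real.sqrt N) ^ 2 / 2 * N = x ^ 2 / 2 := by
    rw [div_pow, Real.sq_sqrt (Nat.cast_nonneg _)]
    have : (N : ℝ) ≠ 0 := by exact_mod_cast h0.ne'
    field_simp
  linarith

theorem concentrationWeight_nonneg (M : MDP S A H) (x : ℝ) {K : ℕ} (D : History S A H K) :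
    0 ≤ concentrationWeight M x D :=
  Finset.sum_nonneg fun _ _ => by positivity

theorem expect_concentrationWeight_le (M : MDP S A H) (ρ : Rule S A H) (x : ℝ) (K : ℕ) :
    expect (runLaw M ρ K) (concentrationWeight M x) ≤
      (K * (H * (Fintype.card S * (Fintype.card A * (2 ^ Fintype.card S * K))))) *
        Real.exp (-(x ^ 2 / 2)) := by
  unfold concentrationWeight
  rw [expect_finset_sum]
  refine (Finset.sum_le_card_nsmul Finset.univ _ (Real.exp (-(x ^ 2 / 2)))
    fun i _ => ?_).trans (le_of_eq ?_)
  · rw [expect_const_mul]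
    refine mul_le_of_le_one_right (Real.exp_pos _).le ?_
    rw [expect_runLaw_past M ρ i.1.2.le (fun D' =>
      Real.exp (x / Real.sqrt (i.2.2.2.2.2 + 1 : ℕ) *
      deviation M D' i.2.1 i.2.2.1 i.2.2.2.1 ((i.2.2.2.2.1 : Set S).indicator 1) -
      (x / Real.sqrt (i.2.2.2.2.2 + 1 : ℕ)) ^ 2 / 2 * visits D' i.2.1 i.2.2.1 i.2.2.2.1))]
    refine expect_exp_deviation_le_one M ρ _ _ _ (fun s => ?_) (fun s => ?_) _ _
    · exact Set.indicator_nonneg (fun _ _ => zero_le_one) s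
    · exact Set.indicator_le_self' (fun _ _ => zero_le_one) s
  · simp [Finset.card_univ, Fintype.card_prod]

end Concentration

/-! ### Pigeonhole bound for the sum of inverse square roots of visit counts. -/

section Pigeonhole

variable {S A : Type*} {H k : ℕ}

/-- The sum over the steps of `1 / √(N + 1)` along an episode. -/
noncomputable def invSqrtVisits (k : ℕ) (D : History S A H k) (e : Episode S A H) : ℝ :=
  ∑ h : Fin H, 1 / Real.sqrt (visits D h (e.state h) (e.action h) + 1)

theorem invSqrtVisits_nonneg (k : ℕ) (D : History S A H k) (e : Episode S A H) :
    0 ≤ invSqrtVisits k D e :=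
  Finset.sum_nonneg fun _ _ => by positivity

theorem invSqrtVisits_le (k : ℕ) (D : History S A H k) (e : Episode S A H) :
    invSqrtVisits k D e ≤ H := by
  refine (Finset.sum_le_card_nsmul Finset.univ _ 1 fun h _ => ?_).trans (by simp)
  rw [div_le_one (by positivity), Real.one_le_sqrt]
  simp

theorem one_div_sqrt_add_one_le (n : ℝ) (hn : 0 ≤ n) :
    2 * Real.sqrt n + 1 / Real.sqrt (n + 1) ≤ 2 * Real.sqrt (n + 1) := by
  have h1 : 0 < Real.sqrt (n + 1) := Real.sqrt_pos.2 (by linarith)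
  have h2 := Real.sq_sqrt hn
  have h3 := Real.sq_sqrt (show 0 ≤ n + 1 by linarith)
  have h4 : 1 / Real.sqrt (n + 1) * Real.sqrt (n + 1) = 1 := by field_simp
  refine le_of_mul_le_mul_right ?_ h1
  nlinarith [sq_nonneg (Real.sqrt (n + 1) - Real.sqrt n)]

variable [Fintype S] [Fintype A]

theorem sum_visits (D : History S A H k) (h : Fin H) :
    ∑ q : S × A, (visits D h q.1 q.2 : ℝ) = k := by
  classical
  simp only [visits_eq_sum]
  rw [Finset.sum_comm]
  have : ∀ τ : Fin k, ∑ q : S × A, visitInd (D τ) h q.1 q.2 = 1 := by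
    intro τ
    rw [Finset.sum_eq_single ((D τ).state h, (D τ).action h)]
    · simp [visitInd]
    · intro q _ hq
      refine if_neg fun h' => hq (Prod.ext h'.1.symm h'.2.symm)
    · simp
  simp [this]

/-- The right side is a potential: a visit raises `2 √N` by at least `1 / √(N + 1)`. -/
theorem cumulative_invSqrtVisits_le_sum (D : History S A H k) :
    cumulative invSqrtVisits D ≤ ∑ h : Fin H, ∑ q : S × A, 2 * Real.sqrt (visits D h q.1 q.2) := by
  classical
  induction k with
  | zero => simpa [cumulative] using by positivity
  | succ k ih =>
    rw [← Fin.snoc_init_self D]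
    set D' : History S A H k := Fin.init D
    set e := D (Fin.last k)
    rw [cumulative_snoc]
    refine (add_le_add_left (ih D') _).trans ?_
    rw [invSqrtVisits, ← Finset.sum_add_distrib]
    refine Finset.sum_le_sum fun h _ => ?_
    have h1 : 1 / Real.sqrt (visits D' h (e.state h) (e.action h) + 1) = ∑ q : S × A,
        visitInd e h q.1 q.2 * (1 / Real.sqrt (visits D' h q.1 q.2 + 1)) := by
      rw [Finset.sum_eq_single (e.state h, e.action h)]
      · simp [visitInd]
      · intro q _ hq
        rw [visitInd, if_neg fun h' => hq (Prod.ext h'.1.symm h'.2.symm), zero_mul]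
      · simp
    rw [h1, ← Finset.sum_add_distrib]
    refine Finset.sum_le_sum fun q _ => ?_
    rw [visits_snoc]
    by_cases hq : e.state h = q.1 ∧ e.action h = q.2
    · rw [visitInd, if_pos hq, one_mul]
      exact one_div_sqrt_add_one_le _ (Nat.cast_nonneg _)
    · simp [visitInd, if_neg hq]

/-- Cauchy–Schwarz over the state-action pairs, whose counts at each step sum to `k`. -/
theorem cumulative_invSqrtVisits_le (D : History S A H k) :
    cumulative invSqrtVisits D ≤
      2 * H * Real.sqrt (Fintype.card S * Fintype.card A * k) := by
  refine (cumulative_invSqrtVisits_le_sum D).trans ?_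
  have h1 : ∀ h ∈ (Finset.univ : Finset (Fin H)),
      ∑ q : S × A, 2 * Real.sqrt (visits D h q.1 q.2) ≤
        2 * Real.sqrt (Fintype.card S * Fintype.card A * k) := by
    intro h _
    rw [← Finset.mul_sum]
    refine mul_le_mul_of_nonneg_left (Real.le_sqrt_of_sq_le ?_) zero_le_two
    have := sq_sum_le_card_mul_sum_sq (s := (Finset.univ : Finset (S × A)))
      (f := fun q => Real.sqrt (visits D h q.1 q.2))
    simp only [Real.sq_sqrt (Nat.cast_nonneg _), sum_visits] at this
    simpa [Finset.card_univ] using this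
  refine (Finset.sum_le_card_nsmul _ _ _ h1).trans (le_of_eq ?_)
  simp
  ring

end Pigeonhole

/-! ### Exponential inequalities uniform in the sign of `β`. -/

section SignedExp

/-- `σ` is the sign of `β`, as a real number. -/
def IsSign (σ β : ℝ) : Prop := (σ = 1 ∧ 0 < β) ∨ (σ = -1 ∧ β < 0)

variable {σ β : ℝ}

theorem IsSign.mul_exp_le_iff (hσ : IsSign σ β) {x y : ℝ} :
    σ * Real.exp (β * x) ≤ σ * Real.exp (β * y) ↔ x ≤ y := by
  rcases hσ with ⟨rfl, h⟩ | ⟨rfl, h⟩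
  · rw [one_mul, one_mul, Real.exp_le_exp, mul_le_mul_iff_right₀ h]
  · rw [neg_one_mul, neg_one_mul, neg_le_neg_iff, Real.exp_le_exp, mul_le_mul_left_of_neg h]

theorem IsSign.le_mul_exp_iff (hσ : IsSign σ β) {x : ℝ} : σ ≤ σ * Real.exp (β * x) ↔ 0 ≤ x := by
  simpa using hσ.mul_exp_le_iff (x := 0) (y := x)

theorem IsSign.abs_exp_sub_one (hσ : IsSign σ β) {x : ℝ} (hx : 0 ≤ x) :
    |Real.exp (β * x) - 1| = σ * Real.exp (β * x) - σ := by
  have h1 := hσ.le_mul_exp_iff.2 hx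
  rcases hσ with ⟨rfl, h⟩ | ⟨rfl, h⟩
  · rw [abs_of_nonneg (by linarith), one_mul]
  · rw [abs_of_nonpos (by linarith)]
    ring

/-- The left side is the distance between `exp (β * r)` and `exp (β * (r + x))`, both lying between
`1` and `exp (β * y)`. This lets the bonus absorb the reward factor. -/
theorem IsSign.exp_mul_abs_le (hσ : IsSign σ β) {r x y : ℝ} (hr0 : 0 ≤ r) (hr1 : r ≤ 1)
    (hx : 0 ≤ x) (hxy : x + 1 ≤ y) :
    Real.exp (β * r) * |Real.exp (β * x) - 1| ≤ |Real.exp (β * y) - 1| := by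
  have hy : Real.exp (β * r) * |Real.exp (β * x) - 1| =
      |Real.exp (β * (r + x)) - Real.exp (β * r)| := by
    rw [← abs_of_pos (Real.exp_pos (β * r)), ← abs_mul, abs_of_pos (Real.exp_pos (β * r)),
      mul_sub, mul_one, ← Real.exp_add, mul_add]
  rw [hy, hσ.abs_exp_sub_one (by linarith)]
  have h1 := hσ.mul_exp_le_iff.2 (show r + x ≤ y by linarith)
  have h2 := hσ.le_mul_exp_iff.2 hr0
  have h3 := hσ.mul_exp_le_iff.2 (show r ≤ r + x by linarith)
  rcases hσ with ⟨rfl, h⟩ | ⟨rfl, h⟩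
  · rw [abs_of_nonneg (by linarith)]
    linarith
  · rw [abs_of_nonpos (by linarith)]
    linarith

/-- A Lipschitz bound for the logarithm, in the form needed for entropic values. -/
theorem IsSign.log_sub_log_le (hσ : IsSign σ β) {u v m : ℝ} (hm : 0 < m) (hu : m ≤ u) (hv : m ≤ v)
    (h : σ * v ≤ σ * u) :
    1 / β * Real.log u - 1 / β * Real.log v ≤ 1 / (|β| * m) * (σ * u - σ * v) := by
  have hu0 := hm.trans_le hu
  have hv0 := hm.trans_le hv
  have key : ∀ {a b : ℝ}, m ≤ b → b ≤ a → Real.log a - Real.log b ≤ 1 / m * (a - b) := by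
    intro a b hb hab
    have hb0 := hm.trans_le hb
    rw [← Real.log_div (hb0.trans_le hab).ne' hb0.ne']
    refine (Real.log_le_sub_one_of_pos (div_pos (hb0.trans_le hab) hb0)).trans ?_
    have e : a / b - 1 = 1 / b * (a - b) := by field_simp
    rw [e]
    exact mul_le_mul_of_nonneg_right (one_div_le_one_div_of_le hm hb) (by linarith)
  rcases hσ with ⟨rfl, hβ⟩ | ⟨rfl, hβ⟩
  · have := mul_le_mul_of_nonneg_left (key hv (by linarith : v ≤ u)) (one_div_pos.2 hβ).le
    rw [abs_of_pos hβ]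
    calc _ = 1 / β * (Real.log u - Real.log v) := by ring
      _ ≤ _ := this
      _ = _ := by field_simp
  · have hβ' : 0 < -β := by linarith
    have := mul_le_mul_of_nonneg_left (key hu (by linarith : u ≤ v)) (one_div_pos.2 hβ').le
    rw [abs_of_neg hβ]
    have hne : β ≠ 0 := hβ.ne
    calc _ = 1 / (-β) * (Real.log v - Real.log u) := by field_simp; ring
      _ ≤ _ := this
      _ = _ := by field_simp; ring

/-- Supplies the common floor `m` of `IsSign.log_sub_log_le` for either sign. -/
theorem IsSign.exp_neg_abs_mul_le (hσ : IsSign σ β) {u y : ℝ} (hy : 0 ≤ y) (h0 : σ ≤ σ * u)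
    (h1 : σ * u ≤ σ * Real.exp (β * y)) :
    Real.exp (-(|β| * y)) ≤ u := by
  rcases hσ with ⟨rfl, h⟩ | ⟨rfl, h⟩
  · have : Real.exp (-(|β| * y)) ≤ 1 := Real.exp_le_one_iff.2 (by
      have := mul_nonneg (abs_nonneg β) hy
      linarith)
    linarith
  · rw [abs_of_neg h, neg_mul, neg_neg]
    linarith

end SignedExp

/-! ### Exponentiated policy values. -/

section PolicyValue

variable {S A : Type*} {H : ℕ}

/-- The exponentiated values `exp(β V_h^π)` of a policy. -/
noncomputable def expValue (M : MDP S A H) (β : ℝ) (π : Policy S A H) : Fin (H + 1) → S → ℝ :=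
  Fin.reverseInduction (motive := fun _ => S → ℝ) (fun _ => 1)
    (fun h U s => Real.exp (β * M.reward h s (π h s)) * expect (M.trans h s (π h s)) U)

theorem expValue_last (M : MDP S A H) (β : ℝ) (π : Policy S A H) (s : S) :
    expValue M β π (Fin.last H) s = 1 := by
  rw [expValue, Fin.reverseInduction_last]

theorem expValue_castSucc (M : MDP S A H) (β : ℝ) (π : Policy S A H) (h : Fin H) (s : S) :
    expValue M β π h.castSucc s =
      Real.exp (β * M.reward h s (π h s)) *
        expect (M.trans h s (π h s)) (expValue M β π h.succ) := by
  rw [expValue, Fin.reverseInduction_castSucc]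

theorem value_eq_log_expValue [Fintype S] (M : MDP S A H) (β : ℝ) (π : Policy S A H) (s : S) :
    value M β π s = 1 / β * Real.log (expValue M β π 0 s) := by
  rw [value, ← expect_pathLaw_exp_sum β M.trans π M.reward (expValue M β π)
    (expValue_last M β π) (expValue_castSucc M β π) s, expect_eq_sum]
  rfl

theorem mul_expValue_mem_Icc [Finite S] {σ β : ℝ} (hσ : IsSign σ β) (M : MDP S A H)
    (π : Policy S A H) (h : Fin (H + 1)) (s : S) :
    σ ≤ σ * expValue M β π h s ∧ σ * expValue M β π h s ≤ σ * Real.exp (β * (H - (h : ℕ))) := by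
  induction h using Fin.reverseInduction generalizing s with
  | last => simp [expValue_last]
  | cast h ih =>
    obtain ⟨hr0, hr1⟩ := M.reward_mem h s (π h s)
    have e : σ * expValue M β π h.castSucc s = Real.exp (β * M.reward h s (π h s)) *
        expect (M.trans h s (π h s)) (fun s' => σ * expValue M β π h.succ s') := by
      rw [expValue_castSucc, expect_const_mul]
      ring
    rw [e]
    have hp := Real.exp_pos (β * M.reward h s (π h s))
    constructor
    · have h1 := mul_le_mul_of_nonneg_left
        (le_expect (M.trans h s (π h s)) fun s' _ => (ih s').1) hp.le
      have h2 := hσ.le_mul_exp_iff.2 hr0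
      linarith
    · have h1 := mul_le_mul_of_nonneg_left
        (expect_le (M.trans h s (π h s)) fun s' _ => (ih s').2) hp.le
      refine h1.trans ?_
      rw [mul_left_comm, ← Real.exp_add, ← mul_add]
      refine hσ.mul_exp_le_iff.2 ?_
      simp
      linarith

end PolicyValue

/-! ### Uniform deviations, least squares, optimism and the regret of one episode. -/

section Estimates

variable {S A : Type*} {H k : ℕ} [Fintype S]

theorem deviation_eq_sum (M : MDP S A H) (D : History S A H k) (h : Fin H) (s : S) (a : A)
    (f : S → ℝ) (B : Finset S) :
    deviation M D h s a ((B : Set S).indicator f) =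
      ∑ s' ∈ B, deviation M D h s a (({s'} : Set S).indicator 1) * f s' := by
  classical
  have e : (B : Set S).indicator f =
      fun y => ∑ s' ∈ B, f s' * ({s'} : Set S).indicator (1 : S → ℝ) y := by
    funext y
    simp [Set.indicator_apply]
  simp only [e, deviation, Finset.sum_mul]
  rw [Finset.sum_comm]
  refine Finset.sum_congr rfl fun τ _ => ?_
  rw [expect_finset_sum, ← Finset.sum_sub_distrib, Finset.mul_sum]
  refine Finset.sum_congr rfl fun s' _ => ?_
  rw [expect_const_mul]
  ring

theorem deviation_le_of_nonneg {M : MDP S A H} {D : History S A H k} {x : ℝ}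
    (hD : Concentrated M x D) (h : Fin H) (s : S) (a : A) {f : S → ℝ} {R : ℝ}
    (h0 : ∀ s, 0 ≤ f s) (h1 : ∀ s, f s ≤ R) (hR : 0 ≤ R) :
    deviation M D h s a f ≤ R * (x * Real.sqrt (visits D h s a)) := by
  classical
  set d : S → ℝ := fun s' => deviation M D h s a (({s'} : Set S).indicator 1) with hd
  -- The extremal subset: dropping negative terms and raising `f` to `R` on the positive ones only
  -- increases the sum.
  set B := Finset.univ.filter fun s' => 0 < d s' with hB
  have e1 : deviation M D h s a f = ∑ s', d s' * f s' := by
    rw [← deviation_eq_sum, Finset.coe_univ, Set.indicator_univ]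
  have e2 : deviation M D h s a ((B : Set S).indicator 1) = ∑ s' ∈ B, d s' := by
    rw [deviation_eq_sum]
    simp only [Pi.one_apply, mul_one, hd]
  calc deviation M D h s a f ≤ ∑ s', if 0 < d s' then R * d s' else 0 := by
        rw [e1]
        refine Finset.sum_le_sum fun s' _ => ?_
        split_ifs with hs
        · rw [mul_comm]
          exact mul_le_mul_of_nonneg_right (h1 s') hs.le
        · exact mul_nonpos_of_nonpos_of_nonneg (not_lt.1 hs) (h0 s')
    _ = R * ∑ s' ∈ B, d s' := by rw [← Finset.sum_filter, Finset.mul_sum]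
    _ ≤ _ := by
        rw [← e2]
        exact mul_le_mul_of_nonneg_left (hD h s a B) hR

/-- Deviations ignore additive constants, so both tails reduce to the nonnegative functions `f - m`
and `m + R - f`. -/
theorem abs_deviation_le {M : MDP S A H} {D : History S A H k} {x : ℝ}
    (hD : Concentrated M x D) (h : Fin H) (s : S) (a : A) {f : S → ℝ} {m R : ℝ}
    (h0 : ∀ s, m ≤ f s) (h1 : ∀ s, f s ≤ m + R) (hR : 0 ≤ R) :
    |deviation M D h s a f| ≤ R * (x * Real.sqrt (visits D h s a)) := by
  rw [abs_le']
  constructor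
  · have := deviation_le_of_nonneg hD h s a (f := fun s => f s - m)
      (fun s => by linarith [h0 s]) (fun s => by linarith [h1 s]) hR
    refine le_trans (le_of_eq ?_) this
    refine Finset.sum_congr rfl fun τ _ => ?_
    rw [expect_sub, expect_const]
    ring
  · have := deviation_le_of_nonneg hD h s a (f := fun s => m + R - f s)
      (fun s => by linarith [h1 s]) (fun s => by linarith [h0 s]) hR
    refine le_trans (le_of_eq ?_) this
    rw [deviation, ← Finset.sum_neg_distrib]
    refine Finset.sum_congr rfl fun τ _ => ?_
    rw [expect_sub, expect_const]
    ring

variable [Fintype A]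

/-- Resetting the single coordinate `(s, a)` to the sample mean `m` lowers the loss by `N * (m - w
(s, a)) ^ 2`, which minimality forces to vanish. -/
theorem visits_mul_lsWeight (r : Fin H → S → A → ℝ) (β : ℝ) (D : History S A H k) (h : Fin H)
    (V : S → ℝ) {s : S} {a : A} (hN : visits D h s a ≠ 0) :
    visits D h s a * lsWeight r β D h V (s, a) =
      ∑ τ, visitInd (D τ) h s a * Real.exp (β * (r h s a + V ((D τ).next h))) := by
  classical
  have hmin : IsMinOn (lsLoss r β D h V) Set.univ (lsWeight r β D h V) :=
    Classical.choose_spec (exists_isMinOn_lsLoss r β D h V)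
  set w := lsWeight r β D h V
  set Y := ∑ τ, visitInd (D τ) h s a * Real.exp (β * (r h s a + V ((D τ).next h))) with hY
  set N : ℝ := ((visits D h s a : ℕ) : ℝ) with hN'
  have hN0 : 0 < N := by rw [hN']; exact_mod_cast Nat.pos_of_ne_zero hN
  set m : ℝ := Y / N with hm
  have hNm : N * m = Y := by rw [hm]; field_simp
  have h1 : lsLoss r β D h V w ≤ lsLoss r β D h V (Function.update w (s, a) m) :=
    hmin (Set.mem_univ _)
  have h2 : lsLoss r β D h V w - lsLoss r β D h V (Function.update w (s, a) m) =
      ∑ τ, visitInd (D τ) h s a * ((m - w (s, a)) *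
        (2 * Real.exp (β * (r h s a + V ((D τ).next h))) - w (s, a) - m)) := by
    unfold lsLoss
    rw [← Finset.sum_sub_distrib]
    refine Finset.sum_congr rfl fun τ _ => ?_
    simp only [feature, dotProduct_single, mul_one]
    by_cases hτ : (D τ).state h = s ∧ (D τ).action h = a
    · rw [visitInd, if_pos hτ, hτ.1, hτ.2, Function.update_self]
      ring
    · rw [visitInd, if_neg hτ, Function.update_of_ne fun h' =>
        hτ ⟨congrArg Prod.fst h', congrArg Prod.snd h'⟩]
      ring
  have h3 : ∑ τ, visitInd (D τ) h s a * ((m - w (s, a)) *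
        (2 * Real.exp (β * (r h s a + V ((D τ).next h))) - w (s, a) - m)) =
      (m - w (s, a)) * (2 * Y - N * (w (s, a) + m)) := by
    rw [hY, hN', visits_eq_sum, Finset.mul_sum, Finset.sum_mul, ← Finset.sum_sub_distrib,
      Finset.mul_sum]
    exact Finset.sum_congr rfl fun _ _ => by ring
  have h4 : N * (m - w (s, a)) ^ 2 ≤ 0 := by
    have : (m - w (s, a)) * (2 * Y - N * (w (s, a) + m)) = N * (m - w (s, a)) ^ 2 := by
      rw [← hNm]; ring
    linarith
  have h5 : m - w (s, a) = 0 := by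
    by_contra h'
    have := mul_pos hN0 (pow_pos (abs_pos.2 h') 2)
    rw [sq_abs] at this
    linarith
  rw [← hNm, sub_eq_zero.1 h5]

theorem bonus_nonneg {c : ℝ} (hc : 0 ≤ c) (β δ : ℝ) (K : ℕ) (D : History S A H k) (h : Fin H)
    (s : S) (a : A) : 0 ≤ bonus c β δ K D h s a := by
  unfold bonus
  positivity

variable [Nonempty A]

theorem estV_last (r : Fin H → S → A → ℝ) (c β δ : ℝ) (K : ℕ) (D : History S A H k) (s : S) :
    estV r c β δ K D (Fin.last H) s = 0 := by
  rw [estV, Fin.reverseInduction_last]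

theorem estV_castSucc (r : Fin H → S → A → ℝ) (c β δ : ℝ) (K : ℕ) (D : History S A H k)
    (h : Fin H) (s : S) : estV r c β δ K D h.castSucc s =
      Finset.univ.sup' Finset.univ_nonempty (estQ r c β δ K D h s) := by
  rw [estV, Fin.reverseInduction_castSucc]
  rfl

theorem estQ_le_estV (r : Fin H → S → A → ℝ) (c β δ : ℝ) (K : ℕ) (D : History S A H k)
    (h : Fin H) (s : S) (a : A) : estQ r c β δ K D h s a ≤ estV r c β δ K D h.castSucc s := by
  rw [estV_castSucc]
  exact Finset.le_sup' _ (Finset.mem_univ a)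

theorem IsGreedy.estV_eq {r : Fin H → S → A → ℝ} {c β δ : ℝ} {K : ℕ} {D : History S A H k}
    {π : Policy S A H} (hπ : IsGreedy r c β δ K D π) (h : Fin H) (s : S) :
    estV r c β δ K D h.castSucc s = estQ r c β δ K D h s (π h s) := by
  refine le_antisymm ?_ (estQ_le_estV r c β δ K D h s _)
  rw [estV_castSucc]
  exact Finset.sup'_le _ _ fun a _ => hπ h s a

theorem estQ_of_visits_eq_zero (r : Fin H → S → A → ℝ) (c β δ : ℝ) (K : ℕ)
    {D : History S A H k} {h : Fin H} {s : S} {a : A} (hN : visits D h s a = 0) :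
    estQ r c β δ K D h s a = H - (h : ℕ) := by
  rw [estQ, qUpdate, if_pos hN]

/-- Multiplication by `σ` merges the `min` and `max` branches of the update into one formula. -/
theorem mul_exp_estQ {σ β : ℝ} (hσ : IsSign σ β) (r : Fin H → S → A → ℝ) {c : ℝ} (hc : 0 ≤ c)
    (δ : ℝ) (K : ℕ) {D : History S A H k} {h : Fin H} {s : S} {a : A}
    (hN : visits D h s a ≠ 0) :
    σ * Real.exp (β * estQ r c β δ K D h s a) = min (σ * Real.exp (β * (H - (h : ℕ))))
      (σ * lsWeight r β D h (estV r c β δ K D h.succ) (s, a) + bonus c β δ K D h s a) := by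
  have hb := bonus_nonneg hc β δ K D h s a
  have hN0 : 0 < (visits D h s a : ℝ) := by exact_mod_cast Nat.pos_of_ne_zero hN
  -- For `β > 0` the logarithm needs a positive argument before `exp` can invert it; the weight is
  -- an average of exponentials.
  have hw0 : 0 < lsWeight r β D h (estV r c β δ K D h.succ) (s, a) := by
    refine pos_of_mul_pos_right (a := (visits D h s a : ℝ)) ?_ hN0.le
    rw [visits_mul_lsWeight r β D h _ hN]
    rw [visits_eq_sum] at hN0
    refine lt_of_le_of_ne (Finset.sum_nonneg fun τ _ => ?_) fun h0 => ?_
    · exact mul_nonneg (by unfold visitInd; split_ifs <;> norm_num) (Real.exp_pos _).le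
    · rw [eq_comm, Finset.sum_eq_zero_iff_of_nonneg fun τ _ =>
        mul_nonneg (by unfold visitInd; split_ifs <;> norm_num) (Real.exp_pos _).le] at h0
      refine hN0.ne' (Finset.sum_eq_zero fun τ hτ => ?_)
      exact (mul_eq_zero.1 (h0 τ hτ)).resolve_right (Real.exp_pos _).ne'
  rw [estQ, qUpdate, if_neg hN]
  rcases hσ with ⟨rfl, hβ⟩ | ⟨rfl, hβ⟩
  · rw [if_pos hβ, one_mul, one_mul, one_mul, ← mul_assoc, mul_one_div_cancel hβ.ne', one_mul,
      Real.exp_log (lt_min (Real.exp_pos _) (by linarith))]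
  · rw [if_neg (not_lt.2 hβ.le), ← mul_assoc, mul_one_div_cancel hβ.ne, one_mul,
      Real.exp_log (lt_max_of_lt_left (Real.exp_pos _)), neg_one_mul, neg_one_mul, neg_one_mul,
      ← min_neg_neg]
    congr 1
    ring_nf

theorem estV_mem_Icc {β : ℝ} (hβ : β ≠ 0) (M : MDP S A H) {c : ℝ} (hc : 0 ≤ c)
    (δ : ℝ) (K : ℕ) (D : History S A H k) (h : Fin (H + 1)) (s : S) :
    0 ≤ estV M.reward c β δ K D h s ∧ estV M.reward c β δ K D h s ≤ H - (h : ℕ) := by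
  obtain ⟨σ, hσ⟩ : ∃ σ, IsSign σ β := by
    rcases hβ.lt_or_gt with h | h
    exacts [⟨-1, Or.inr ⟨rfl, h⟩⟩, ⟨1, Or.inl ⟨rfl, h⟩⟩]
  induction h using Fin.reverseInduction generalizing s with
  | last => simp [estV_last]
  | cast h ih =>
    have hH : (0 : ℝ) ≤ H - (h : ℕ) := by
      rw [sub_nonneg]; exact_mod_cast h.2.le
    have hQ : ∀ a, 0 ≤ estQ M.reward c β δ K D h s a ∧
        estQ M.reward c β δ K D h s a ≤ H - (h : ℕ) := by
      intro a
      by_cases hN : visits D h s a = 0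
      · rw [estQ_of_visits_eq_zero _ _ _ _ _ hN]
        exact ⟨hH, le_rfl⟩
      have e := mul_exp_estQ hσ M.reward hc δ K hN
      constructor
      · rw [← hσ.le_mul_exp_iff, e]
        refine le_min (hσ.le_mul_exp_iff.2 hH) (le_add_of_le_of_nonneg ?_
          (bonus_nonneg hc β δ K D h s a))
        have hN0 : 0 < (visits D h s a : ℝ) := by exact_mod_cast Nat.pos_of_ne_zero hN
        refine le_of_mul_le_mul_left ?_ hN0
        rw [mul_left_comm, visits_mul_lsWeight _ _ _ _ _ hN, visits_eq_sum, Finset.sum_mul,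
          Finset.mul_sum]
        refine Finset.sum_le_sum fun τ _ => ?_
        rw [mul_left_comm]
        refine mul_le_mul_of_nonneg_left (hσ.le_mul_exp_iff.2 ?_)
          (by unfold visitInd; split_ifs <;> norm_num)
        exact add_nonneg (M.reward_mem h s a).1 (ih _).1
      · rw [← hσ.mul_exp_le_iff, e]
        exact min_le_left _ _
    rw [estV_castSucc]
    obtain ⟨a⟩ := ‹Nonempty A›
    exact ⟨(hQ a).1.trans (Finset.le_sup' _ (Finset.mem_univ a)),
      Finset.sup'_le _ _ fun a _ => (hQ a).2⟩

/-- On the concentration event the bonus dominates the error of the empirical backup. -/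
theorem abs_mul_lsWeight_sub_le {σ β : ℝ} (hσ : IsSign σ β) {M : MDP S A H} {c : ℝ} (hc : 0 ≤ c)
    (δ : ℝ) (K : ℕ) {D : History S A H k}
    (hD : Concentrated M (c * Real.sqrt (Fintype.card S *
      Real.log (2 * Fintype.card S * Fintype.card A * (K * H : ℝ) / δ))) D)
    {h : Fin H} {s : S} {a : A} (hN : visits D h s a ≠ 0) :
    |σ * lsWeight M.reward β D h (estV M.reward c β δ K D h.succ) (s, a) -
      Real.exp (β * M.reward h s a) * expect (M.trans h s a)
        (fun s' => σ * Real.exp (β * estV M.reward c β δ K D h.succ s'))| ≤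
      bonus c β δ K D h s a := by
  have hβ : β ≠ 0 := by rcases hσ with ⟨_, h⟩ | ⟨_, h⟩; exacts [h.ne', h.ne]
  set V := estV M.reward c β δ K D h.succ with hV
  set ι := Real.log (2 * Fintype.card S * Fintype.card A * (K * H : ℝ) / δ)
  set f : S → ℝ := fun s' => σ * Real.exp (β * V s') with hf
  have hN0 : 0 < (visits D h s a : ℝ) := by exact_mod_cast Nat.pos_of_ne_zero hN
  set N : ℝ := ((visits D h s a : ℕ) : ℝ) with hN'
  have hs : 0 < Real.sqrt N := Real.sqrt_pos.2 hN0
  -- The next-step estimates lie in `[0, x]`. Since `x + 1 ≤ H`, there is room for one more reward.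
  set x : ℝ := (H : ℝ) - (h.succ : ℕ) with hx
  have hx0 : 0 ≤ x := by rw [hx, sub_nonneg]; exact_mod_cast h.succ.is_le
  have hxH : x + 1 ≤ H := by
    have := (Nat.cast_nonneg (h : ℕ) : (0 : ℝ) ≤ (h : ℕ))
    simp only [hx, Fin.val_succ, Nat.cast_add, Nat.cast_one]
    linarith
  have hmem := estV_mem_Icc hβ M hc δ K D h.succ
  have hdev := abs_deviation_le hD h s a (f := f) (m := σ) (R := |Real.exp (β * x) - 1|)
    (fun s' => hσ.le_mul_exp_iff.2 (hmem s').1)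
    (fun s' => by
      rw [hσ.abs_exp_sub_one hx0, add_sub_cancel]
      exact hσ.mul_exp_le_iff.2 (hmem s').2) (abs_nonneg _)
  have e1 : N * (σ * lsWeight M.reward β D h V (s, a) -
      Real.exp (β * M.reward h s a) * expect (M.trans h s a) f) =
      Real.exp (β * M.reward h s a) * deviation M D h s a f := by
    rw [mul_sub, mul_left_comm, visits_mul_lsWeight _ _ _ _ _ hN, hN', visits_eq_sum, deviation,
      Finset.mul_sum, Finset.mul_sum, Finset.sum_mul, ← Finset.sum_sub_distrib]
    refine Finset.sum_congr rfl fun τ _ => ?_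
    simp only [hf, mul_add, Real.exp_add]
    ring
  have hb : N * bonus c β δ K D h s a = |Real.exp (β * H) - 1| *
      (c * Real.sqrt (Fintype.card S * ι) * Real.sqrt N) := by
    rw [bonus, Real.sqrt_div' _ hN0.le]
    have : N = Real.sqrt N * Real.sqrt N := (Real.mul_self_sqrt hN0.le).symm
    change N * (c * |Real.exp (β * H) - 1| * (Real.sqrt (Fintype.card S * ι) / Real.sqrt N)) = _
    nth_rewrite 1 [this]
    field_simp
  refine le_of_mul_le_mul_left ?_ hN0
  rw [hb]
  have hcs : 0 ≤ c * Real.sqrt (Fintype.card S * ι) * Real.sqrt N := by positivity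
  calc N * |_| = |N * (σ * lsWeight M.reward β D h V (s, a) -
      Real.exp (β * M.reward h s a) * expect (M.trans h s a) f)| := by
        rw [abs_mul, abs_of_pos hN0]
    _ = Real.exp (β * M.reward h s a) * |deviation M D h s a f| := by
        rw [e1, abs_mul, abs_of_pos (Real.exp_pos _)]
    _ ≤ Real.exp (β * M.reward h s a) * (|Real.exp (β * x) - 1| *
      (c * Real.sqrt (Fintype.card S * ι) * Real.sqrt N)) :=
        mul_le_mul_of_nonneg_left hdev (Real.exp_pos _).le
    _ ≤ _ := by
        rw [← mul_assoc]
        exact mul_le_mul_of_nonneg_right (hσ.exp_mul_abs_le (M.reward_mem h s a).1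
          (M.reward_mem h s a).2 hx0 hxH) hcs

/-- Optimism: on the concentration event the estimates dominate the values of every policy. -/
theorem mul_expValue_le {σ β : ℝ} (hσ : IsSign σ β) {M : MDP S A H} {c : ℝ} (hc : 0 ≤ c)
    (δ : ℝ) (K : ℕ) {D : History S A H k}
    (hD : Concentrated M (c * Real.sqrt (Fintype.card S *
      Real.log (2 * Fintype.card S * Fintype.card A * (K * H : ℝ) / δ))) D)
    (π : Policy S A H) (h : Fin (H + 1)) (s : S) :
    σ * expValue M β π h s ≤ σ * Real.exp (β * estV M.reward c β δ K D h s) := by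
  induction h using Fin.reverseInduction generalizing s with
  | last => simp [expValue_last, estV_last]
  | cast h ih =>
    have hup := (mul_expValue_mem_Icc hσ M π h.castSucc s).2
    refine le_trans ?_ (hσ.mul_exp_le_iff.2 (estQ_le_estV M.reward c β δ K D h s (π h s)))
    -- An unvisited pair keeps the largest conceivable value, so optimism is automatic there.
    by_cases hN : visits D h s (π h s) = 0
    · rw [estQ_of_visits_eq_zero _ _ _ _ _ hN]
      exact hup
    · rw [mul_exp_estQ hσ M.reward hc δ K hN]
      refine le_min hup ?_
      have h1 := (abs_le.1 (abs_mul_lsWeight_sub_le hσ hc δ K hD hN)).1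
      have h2 := mul_le_mul_of_nonneg_left (expect_mono (M.trans h s (π h s)) fun s' _ => ih s')
        (Real.exp_pos (β * M.reward h s (π h s))).le
      rw [expect_const_mul] at h2
      rw [expValue_castSucc, mul_left_comm]
      linarith

/-- The one-step recursion for the estimation error of a greedy policy. -/
theorem estimation_error_step {σ β : ℝ} (hσ : IsSign σ β) {M : MDP S A H} {c : ℝ} (hc : 0 ≤ c)
    (δ : ℝ) (K : ℕ) {D : History S A H k} {x : ℝ} (hx : x = c * Real.sqrt (Fintype.card S *
      Real.log (2 * Fintype.card S * Fintype.card A * (K * H : ℝ) / δ))) (hx1 : 1 ≤ 4 * x)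
    (hD : Concentrated M x D) {π : Policy S A H} (hπ : IsGreedy M.reward c β δ K D π)
    (h : Fin H) (s : S) :
    σ * Real.exp (β * estV M.reward c β δ K D h.castSucc s) - σ * expValue M β π h.castSucc s ≤
      4 * |Real.exp (β * H) - 1| * x * (1 / Real.sqrt (visits D h s (π h s) + 1)) +
      Real.exp |β| * expect (M.trans h s (π h s)) (fun s' =>
        σ * Real.exp (β * estV M.reward c β δ K D h.succ s') - σ * expValue M β π h.succ s') := by
  rw [hx] at hD
  have hopt := mul_expValue_le hσ hc δ K hD π h.succ
  obtain ⟨hr0, hr1⟩ := M.reward_mem h s (π h s)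
  set R := |Real.exp (β * H) - 1| with hR
  have hR0 : 0 ≤ R := abs_nonneg _
  -- Optimism makes the next gap nonnegative, which allows enlarging the reward factor to `exp |β|`.
  have hE0 : 0 ≤ expect (M.trans h s (π h s)) (fun s' =>
        σ * Real.exp (β * estV M.reward c β δ K D h.succ s') - σ * expValue M β π h.succ s') :=
    expect_nonneg _ fun s' => sub_nonneg.2 (hopt s')
  rw [hπ.estV_eq]
  -- Without visits the gap is at most `R`, and `1 ≤ 4 * x` lets the source term at `N = 0` cover
  -- it.
  by_cases hN : visits D h s (π h s) = 0
  · have hH : (0 : ℝ) ≤ H - (h : ℕ) := by rw [sub_nonneg]; exact_mod_cast h.2.le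
    have h1 := (mul_expValue_mem_Icc hσ M π h.castSucc s).1
    have h2 := hσ.abs_exp_sub_one (Nat.cast_nonneg H)
    have h3 := hσ.mul_exp_le_iff.2 (show (H : ℝ) - (h : ℕ) ≤ H by simp)
    rw [estQ_of_visits_eq_zero _ _ _ _ _ hN, hN]
    have h4 := mul_nonneg (Real.exp_pos |β|).le hE0
    have h5 := mul_le_mul_of_nonneg_left hx1 hR0
    simp only [Nat.cast_zero, zero_add, Real.sqrt_one, div_one, mul_one]
    linarith
  · have hN1 : (1 : ℝ) ≤ visits D h s (π h s) := by exact_mod_cast Nat.pos_of_ne_zero hN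
    set N : ℝ := ((visits D h s (π h s) : ℕ) : ℝ) with hN'
    -- The bonus enters twice, in the estimate and as the bound on the backup error; passing from
    -- `N` to `N + 1` costs another `2`, whence the constant `4`.
    have h1 := (abs_le.1 (abs_mul_lsWeight_sub_le hσ hc δ K hD hN)).2
    have h2 : σ * Real.exp (β * estQ M.reward c β δ K D h s (π h s)) ≤ _ :=
      (mul_exp_estQ hσ M.reward hc δ K hN).le.trans (min_le_right _ _)
    have h3 : bonus c β δ K D h s (π h s) ≤ 2 * R * x * (1 / Real.sqrt (N + 1)) := by
      rw [bonus, Real.sqrt_div' _ (Nat.cast_nonneg _), ← hN', ← hR]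
      have e : c * R * (Real.sqrt (Fintype.card S *
        Real.log (2 * Fintype.card S * Fintype.card A * (K * H : ℝ) / δ)) / Real.sqrt N) =
          R * x * (1 / Real.sqrt N) := by rw [hx]; ring
      rw [e]
      have hs : 0 < Real.sqrt N := Real.sqrt_pos.2 (by linarith)
      have h4 : Real.sqrt (N + 1) ≤ 2 * Real.sqrt N := by
        rw [show (2 : ℝ) = Real.sqrt (2 ^ 2) by rw [Real.sqrt_sq zero_le_two],
          ← Real.sqrt_mul (by norm_num)]
        exact Real.sqrt_le_sqrt (by linarith)
      have h5 : 1 / Real.sqrt N ≤ 2 * (1 / Real.sqrt (N + 1)) := by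
        rw [mul_one_div, div_le_div_iff₀ hs (Real.sqrt_pos.2 (by linarith))]
        linarith
      have := mul_le_mul_of_nonneg_left h5 (mul_nonneg hR0 (by linarith : 0 ≤ x))
      linarith
    have h6 : Real.exp (β * M.reward h s (π h s)) ≤ Real.exp |β| := by
      refine Real.exp_le_exp.2 ((le_abs_self _).trans ?_)
      rw [abs_mul, abs_of_nonneg hr0]
      exact mul_le_of_le_one_right (abs_nonneg _) hr1
    have h7 := mul_le_mul_of_nonneg_right h6 hE0
    rw [expect_sub, expect_const_mul _ σ (expValue M β π h.succ)] at h7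
    rw [expValue_castSucc, expect_sub, expect_const_mul _ σ (expValue M β π h.succ)]
    linarith

/-- The regret of one episode is controlled by the expected bonuses along its path. -/
theorem optValue_sub_value_le [Nonempty S] {β : ℝ} (hβ : β ≠ 0) {M : MDP S A H} {c : ℝ}
    (hc : 0 ≤ c) (δ : ℝ) (K : ℕ) {D : History S A H k} {x : ℝ}
    (hx : x = c * Real.sqrt (Fintype.card S *
      Real.log (2 * Fintype.card S * Fintype.card A * (K * H : ℝ) / δ))) (hx1 : 1 ≤ 4 * x)
    (hD : Concentrated M x D) {π : Policy S A H} (hπ : IsGreedy M.reward c β δ K D π) (s : S) :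
    optValue M β s - value M β π s ≤ (Real.exp (3 * (|β| * H)) - 1) / |β| * (4 * x) *
      expect (pathLaw M.trans π s) (fun y => invSqrtVisits k D (π, y)) := by
  obtain ⟨σ, hσ⟩ : ∃ σ, IsSign σ β := by
    rcases hβ.lt_or_gt with h | h
    exacts [⟨-1, Or.inr ⟨rfl, h⟩⟩, ⟨1, Or.inl ⟨rfl, h⟩⟩]
  set V := estV M.reward c β δ K D with hV
  have hmem := estV_mem_Icc hβ M hc δ K D
  have hH : (0 : ℝ) ≤ H := Nat.cast_nonneg H
  have hb := abs_pos.2 hβ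
  have hD' := hD
  rw [hx] at hD'
  have hVE : ∀ y : ℝ, 1 / β * Real.log (Real.exp (β * y)) = y := fun y => by
    rw [Real.log_exp]; field_simp
  have hm := Real.exp_pos (-(|β| * H))
  have hlowV : ∀ s, Real.exp (-(|β| * H)) ≤ Real.exp (β * V 0 s) := fun s =>
    hσ.exp_neg_abs_mul_le hH (hσ.le_mul_exp_iff.2 (hmem 0 s).1)
      (hσ.mul_exp_le_iff.2 (by simpa using (hmem 0 s).2))
  have hlowU : ∀ π : Policy S A H, Real.exp (-(|β| * H)) ≤ expValue M β π 0 s := fun π =>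
    hσ.exp_neg_abs_mul_le hH (mul_expValue_mem_Icc hσ M π 0 s).1
      (by simpa using (mul_expValue_mem_Icc hσ M π 0 s).2)
  have hopt : optValue M β s ≤ V 0 s := by
    refine ciSup_le fun π' => ?_
    have h1 := mul_expValue_le hσ hc δ K hD' π' 0 s
    have hp := hm.trans_le (hlowU π')
    have e : expValue M β π' 0 s = Real.exp (β * value M β π' s) := by
      rw [value_eq_log_expValue, ← mul_assoc, mul_one_div_cancel hβ, one_mul, Real.exp_log hp]
    rw [e] at h1
    exact hσ.mul_exp_le_iff.1 h1
  have h1 := hσ.log_sub_log_le hm (hlowV s) (hlowU π) (mul_expValue_le hσ hc δ K hD' π 0 s)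
  rw [hVE, ← value_eq_log_expValue] at h1
  set R := |Real.exp (β * H) - 1| with hR
  have h2 := le_pow_mul_expect_pathLaw (Real.one_le_exp (abs_nonneg β)) M.trans π
    (fun h s => 4 * R * x * (1 / Real.sqrt (visits D h s (π h s) + 1)))
    (fun h s => by have : 0 ≤ x := by linarith
                   positivity)
    (fun h s => σ * Real.exp (β * V h s) - σ * expValue M β π h s)
    (fun s => by simp [hV, estV_last, expValue_last])
    (estimation_error_step hσ hc δ K hx hx1 hD hπ) s
  simp only [← Finset.mul_sum] at h2
  rw [expect_const_mul] at h2
  change _ ≤ _ * (_ * expect (pathLaw M.trans π s) (fun y => invSqrtVisits k D (π, y))) at h2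
  set Φ := expect (pathLaw M.trans π s) (fun y => invSqrtVisits k D (π, y)) with hΦ
  have hΦ0 : 0 ≤ Φ := expect_nonneg _ fun _ => invSqrtVisits_nonneg _ _ _
  have hRle : R ≤ Real.exp (|β| * H) - 1 := by
    have h3 := Real.add_one_le_exp (β * H)
    rw [hR]
    rcases hσ with ⟨-, h⟩ | ⟨-, h⟩
    · rw [abs_of_pos h, abs_of_nonneg]
      exact sub_nonneg.2 (Real.one_le_exp (mul_nonneg h.le hH))
    · have h4 : Real.exp (β * H) * Real.exp (-(β * H)) = 1 := by rw [← Real.exp_add]; simp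
      have h5 : Real.exp (β * H) ≤ 1 := Real.exp_le_one_iff.2
        (mul_nonpos_of_nonpos_of_nonneg h.le hH)
      rw [abs_of_neg h, abs_of_nonpos (by linarith), neg_mul]
      -- With `t = exp (β * H)` this is `1 - t ≤ 1 / t - 1`.
      nlinarith [Real.exp_pos (β * H), sq_nonneg (Real.exp (-(β * H)) - 1)]
  have h3 : 1 / (|β| * Real.exp (-(|β| * H))) * (Real.exp |β| ^ H * (4 * R * x * Φ)) ≤
      (Real.exp (3 * (|β| * H)) - 1) / |β| * (4 * x) * Φ := by
    have e1 : Real.exp |β| ^ H = Real.exp (|β| * H) := by rw [← Real.exp_nat_mul, mul_comm]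
    have e2 : 1 / (|β| * Real.exp (-(|β| * H))) = Real.exp (|β| * H) / |β| := by
      rw [Real.exp_neg]; field_simp
    set E := Real.exp (|β| * H) with hE
    have e3 : Real.exp (3 * (|β| * H)) = E ^ 3 := by rw [hE, ← Real.exp_nat_mul]; norm_num
    have hE1 : 1 ≤ E := Real.one_le_exp (mul_nonneg hb.le hH)
    rw [e1, e2, e3]
    have h4 : E * (E * R) ≤ E ^ 3 - 1 := by
      have := mul_le_mul_of_nonneg_left hRle (show 0 ≤ E * E by positivity)
      nlinarith
    have h5 : 0 ≤ 1 / |β| * (4 * x) * Φ :=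
      mul_nonneg (mul_nonneg (one_div_pos.2 hb).le (by linarith)) hΦ0
    calc _ = E * (E * R) * (1 / |β| * (4 * x) * Φ) := by ring
      _ ≤ (E ^ 3 - 1) * (1 / |β| * (4 * x) * Φ) := mul_le_mul_of_nonneg_right h4 h5
      _ = _ := by ring
  have h6 := mul_le_mul_of_nonneg_left h2
    (show 0 ≤ 1 / (|β| * Real.exp (-(|β| * H))) by positivity)
  linarith

end Estimates

/-! ### Greediness along the run and numerical bounds. -/

section FinalBounds

theorem IsRSVI.isGreedy_past {S A : Type*} {H K : ℕ} [Fintype S] [Fintype A] [Nonempty A]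
    {M : MDP S A H} {c β δ : ℝ} {ρ : Rule S A H} (hρ : IsRSVI M.reward c β δ K ρ)
    {D : History S A H K} (hD : D ∈ (runLaw M ρ K).support) (k : Fin K) :
    IsGreedy M.reward c β δ K (past D k.2.le) (D k).1 := by
  refine forall_mem_support_runLaw (K := K) (fun j (D : History S A H j) => ∀ i : Fin j,
    IsGreedy M.reward c β δ K (past D i.2.le) (D i).1) (fun i => i.elim0) ?_ le_rfl hD k
  intro j hj D ih q hq x i
  induction i using Fin.lastCases with
  | last =>
    rw [Fin.snoc_last]
    have := hρ j hj D q hq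
    rwa [← past_self D, ← past_snoc D (q.2, x) le_rfl] at this
  | cast i =>
    rw [Fin.snoc_castSucc]
    have := ih i
    rwa [← past_snoc D (q.2, x) i.2.le] at this

/-- Bernoulli's inequality for the `H`-th power of `exp (3 * (b * H))`. -/
theorem div_le_mul_expFactor {b : ℝ} (hb : 0 < b) {H : ℕ} (hH : 0 < H) :
    (Real.exp (3 * (b * H)) - 1) / b ≤ H * expFactor (b * (H : ℝ) ^ 2) := by
  have hH' : (0 : ℝ) < H := by exact_mod_cast hH
  have h1 := one_add_mul_le_pow (a := Real.exp (3 * (b * H)) - 1)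
    (by linarith [Real.exp_pos (3 * (b * H))]) H
  rw [add_sub_cancel, ← Real.exp_nat_mul,
    show (H : ℝ) * (3 * (b * H)) = 3 * (b * (H : ℝ) ^ 2) by ring] at h1
  have e : H * expFactor (b * (H : ℝ) ^ 2) =
      (Real.exp (3 * (b * (H : ℝ) ^ 2)) - 1) / (H * b) := by
    rw [expFactor]; field_simp
  rw [e, div_le_div_iff₀ hb (by positivity)]
  nlinarith

/-- With `G = √(n² m k l²)`, each product of two roots is at most `2 * G`, the first because `l ≤ 4
* l ^ 2`. Thus `6 = 2 * 2 + 2`. -/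
theorem sqrt_mul_add_le {n m k l h : ℝ} (hn : 1 ≤ n) (hm : 1 ≤ m) (hk : 0 ≤ k) (hl : 1 / 2 ≤ l)
    (_hh : 0 ≤ h) :
    h * Real.sqrt (n * l) * (2 * h * Real.sqrt (n * m * k) + h * Real.sqrt (2 * k * l)) ≤
      6 * Real.sqrt (h ^ 3 * n ^ 2 * m * (k * h) * l ^ 2) := by
  set G := Real.sqrt (n ^ 2 * m * k * l ^ 2) with hG
  have e : Real.sqrt (h ^ 3 * n ^ 2 * m * (k * h) * l ^ 2) = h ^ 2 * G := by
    rw [show h ^ 3 * n ^ 2 * m * (k * h) * l ^ 2 = (h ^ 2) ^ 2 * (n ^ 2 * m * k * l ^ 2) by ring,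
      Real.sqrt_mul (by positivity), Real.sqrt_sq (by positivity)]
  have e2 : 2 * G = Real.sqrt (4 * (n ^ 2 * m * k * l ^ 2)) := by
    rw [show (4 : ℝ) = 2 ^ 2 by norm_num, Real.sqrt_mul (by positivity),
      Real.sqrt_sq zero_le_two]
  have h1 : Real.sqrt (n * l) * Real.sqrt (n * m * k) ≤ 2 * G := by
    rw [e2, ← Real.sqrt_mul (by nlinarith)]
    refine Real.sqrt_le_sqrt ?_
    have : 0 ≤ n ^ 2 * m * k * l := by
      have : 0 ≤ l := by linarith
      positivity
    nlinarith
  have h2 : Real.sqrt (n * l) * Real.sqrt (2 * k * l) ≤ 2 * G := by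
    rw [e2, ← Real.sqrt_mul (by nlinarith)]
    refine Real.sqrt_le_sqrt ?_
    have h3 : n ≤ n ^ 2 * m := by nlinarith
    have h4 := mul_le_mul_of_nonneg_right h3 (show 0 ≤ k * l ^ 2 by positivity)
    have h5 : 0 ≤ n ^ 2 * m * k * l ^ 2 := by positivity
    nlinarith
  rw [e]
  have h6 := mul_le_mul_of_nonneg_left h1 (show 0 ≤ 2 * h ^ 2 by positivity)
  have h7 := mul_le_mul_of_nonneg_left h2 (show 0 ≤ h ^ 2 by positivity)
  nlinarith

/-- With `q = exp (-ι) = δ / (2 n m K H)`, the constant `3` gives `9 n ι / 2 ≥ (n + 3) ι`, a factor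
`q ^ (n + 3)`. Here `q ^ n` pays for the `2 ^ n` subsets, one `q` for `n m H K` (leaving `δ / 2`)
and one for the second `K`. The Azuma term is at most the other `δ / 2`. -/
theorem failure_probability_le {n m K H : ℕ} (hn : 0 < n) (hm : 0 < m) (hK : 0 < K) (hH : 0 < H)
    {δ : ℝ} (hδ0 : 0 < δ) (hδ1 : δ ≤ 1) :
    (K * (H * (n * (m * (2 ^ n * K)))) : ℝ) * Real.exp (-((3 * Real.sqrt (n *
      Real.log (2 * n * m * (K * H : ℝ) / δ))) ^ 2 / 2)) +
      Real.exp (-Real.log (2 * n * m * (K * H : ℝ) / δ)) ≤ δ := by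
  have hn' : (1 : ℝ) ≤ n := by exact_mod_cast hn
  have hm' : (1 : ℝ) ≤ m := by exact_mod_cast hm
  have hK' : (1 : ℝ) ≤ K := by exact_mod_cast hK
  have hH' : (1 : ℝ) ≤ H := by exact_mod_cast hH
  have hW : (1 : ℝ) ≤ n * m * H :=
    one_le_mul_of_one_le_of_one_le (one_le_mul_of_one_le_of_one_le hn' hm') hH'
  have hWK : (1 : ℝ) ≤ n * m * H * K := one_le_mul_of_one_le_of_one_le hW hK'
  set L : ℝ := 2 * n * m * (K * H : ℝ) / δ with hL
  have hL0 : 0 < L := by positivity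
  have hL2 : 2 ≤ L := by
    rw [hL, le_div_iff₀ hδ0]
    nlinarith
  have hι : 0 ≤ Real.log L := Real.log_nonneg (by linarith)
  set q := Real.exp (-Real.log L) with hq
  have hqL : q = L⁻¹ := by rw [hq, Real.exp_neg, Real.exp_log hL0]
  have hq0 : 0 < q := Real.exp_pos _
  have hq2 : 2 * q ≤ 1 := by
    rw [hqL, mul_inv_le_iff₀ hL0]
    linarith
  have hWq : n * m * H * K * q = δ / 2 := by
    rw [hqL, hL]
    field_simp
  have hKq : K * q ≤ 1 := by
    have : K * q ≤ n * m * H * (K * q) := le_mul_of_one_le_left (by positivity) hW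
    nlinarith
  have hexp : Real.exp (-((3 * Real.sqrt (n * Real.log L)) ^ 2 / 2)) ≤ q ^ (n + 3) := by
    rw [hq, ← Real.exp_nat_mul, mul_pow, Real.sq_sqrt (by positivity)]
    refine Real.exp_le_exp.2 ?_
    push_cast
    nlinarith
  have h2q : 2 ^ n * q ^ n ≤ 1 := by
    rw [← mul_pow]
    exact pow_le_one₀ (by positivity) hq2
  have h1 : (K * (H * (n * (m * (2 ^ n * K)))) : ℝ) * q ^ (n + 3) ≤ δ / 2 := by
    calc _ = (n * m * H * K * q) * ((K * q) * ((2 ^ n * q ^ n) * q)) := by ring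
      _ ≤ (n * m * H * K * q) * (1 * (1 * 1)) := by
          gcongr
          linarith
      _ = δ / 2 := by rw [hWq]; ring
  have h2 : q ≤ δ / 2 := by
    rw [← hWq]
    exact le_mul_of_one_le_left hq0.le hWK
  have h3 := mul_le_mul_of_nonneg_left hexp
    (show (0 : ℝ) ≤ K * (H * (n * (m * (2 ^ n * K)))) by positivity)
  linarith

end FinalBounds

end RiskRL

/-! ### The regret bound. -/

theorem theorem1 :
    ∃ c > (0 : ℝ), ∃ C > (0 : ℝ),
      ∀ (S : Type*) (A : Type*) [Fintype S] [Fintype A] [Nonempty S] [Nonempty A]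
        (H K : ℕ) (_ : 0 < H) (_ : 0 < K) (M : RiskRL.MDP S A H)
        (β : ℝ) (_ : β ≠ 0) (δ : ℝ) (_ : 0 < δ) (_ : δ ≤ 1)
        (ρ : RiskRL.Rule S A H) (_ : RiskRL.IsRSVI M.reward c β δ K ρ),
        ENNReal.ofReal (1 - δ) ≤
          (RiskRL.runLaw M ρ K).toOuterMeasure
            {D | RiskRL.regret M β D ≤
              C * RiskRL.expFactor (|β| * (H : ℝ) ^ 2) *
                Real.sqrt ((H : ℝ) ^ 3 * (Fintype.card S : ℝ) ^ 2 * (Fintype.card A : ℝ) *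
                  (K * H : ℝ) *
                  Real.log (2 * Fintype.card S * Fintype.card A * (K * H : ℝ) / δ) ^ 2)} := by
  -- `72 = 4 * 3 * 6`: the `4` of the one-step recursion, the bonus constant `3`, and the `6` of
  -- `sqrt_mul_add_le`.
  refine ⟨3, by norm_num, 72, by norm_num, ?_⟩
  intro S A _ _ _ _ H K hH hK M β hβ δ hδ0 hδ1 ρ hρ
  have hn : 0 < Fintype.card S := Fintype.card_pos
  have hm : 0 < Fintype.card A := Fintype.card_pos
  have hn' : (1 : ℝ) ≤ Fintype.card S := by exact_mod_cast hn
  have hm' : (1 : ℝ) ≤ Fintype.card A := by exact_mod_cast hm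
  have hK' : (1 : ℝ) ≤ K := by exact_mod_cast hK
  have hH' : (1 : ℝ) ≤ H := by exact_mod_cast hH
  have hprob := RiskRL.failure_probability_le hn hm hK hH hδ0 hδ1
  set ι := Real.log (2 * Fintype.card S * Fintype.card A * (K * H : ℝ) / δ) with hι
  have hι2 : 1 / 2 ≤ ι := by
    have h1 : (2 : ℝ) ≤ 2 * Fintype.card S * Fintype.card A * (K * H : ℝ) / δ := by
      rw [le_div_iff₀ hδ0]
      have h2 := one_le_mul_of_one_le_of_one_le (one_le_mul_of_one_le_of_one_le hn' hm')
        (one_le_mul_of_one_le_of_one_le hK' hH')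
      nlinarith
    have h2 := Real.log_le_log two_pos h1
    linarith [Real.log_two_gt_d9]
  set x := 3 * Real.sqrt (Fintype.card S * ι) with hx
  have hx1 : 1 ≤ 4 * x := by
    have : 1 / 2 ≤ Real.sqrt (Fintype.card S * ι) := Real.le_sqrt_of_sq_le (by nlinarith)
    linarith
  have hx0 : 0 ≤ x := by linarith
  -- The Azuma tilt: the compensator equals `ι`, and at the threshold `H √(2 K ι)` the linear term
  -- equals `2 * ι`, so the exponent `-ι + 2 * ι - ι` reaches zero.
  set l := Real.sqrt (2 * K * ι) / (K * H) with hl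
  have hr2 : Real.sqrt (2 * K * ι) ^ 2 = 2 * K * ι := Real.sq_sqrt (by positivity)
  have hr0 : 0 < Real.sqrt (2 * K * ι) := Real.sqrt_pos.2 (by positivity)
  have hlH : K * ((l * H) ^ 2 / 2) = ι := by
    have : l * H = Real.sqrt (2 * K * ι) / K := by rw [hl]; field_simp
    rw [this, div_pow, hr2]
    field_simp
  set Φ : (k : ℕ) → RiskRL.History S A H k → RiskRL.Episode S A H → ℝ := fun k D e =>
    RiskRL.expect (RiskRL.pathLaw M.trans e.1 (e.2 0))
      fun x => RiskRL.invSqrtVisits k D (e.1, x) with hΦ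
  refine RiskRL.ofReal_one_sub_le_toOuterMeasure _
    (f := fun D => RiskRL.concentrationWeight M x D + Real.exp (-ι) * Real.exp
      (l * (RiskRL.cumulative Φ D - RiskRL.cumulative RiskRL.invSqrtVisits D) -
        K * ((l * H) ^ 2 / 2)))
    (fun D => add_nonneg (RiskRL.concentrationWeight_nonneg M x D) (by positivity)) ?_ ?_
  · intro D hD hreg
    by_contra hlt
    rw [not_le] at hlt
    refine hreg ?_
    have hw0 := RiskRL.concentrationWeight_nonneg M x D
    have hconc : ∀ k : Fin K, RiskRL.Concentrated M x (RiskRL.past D k.2.le) := by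
      intro k
      by_contra hk
      have := RiskRL.one_le_concentrationWeight M hx0 hk
      have : 0 < Real.exp (-ι) * Real.exp
        (l * (RiskRL.cumulative Φ D - RiskRL.cumulative RiskRL.invSqrtVisits D) -
        K * ((l * H) ^ 2 / 2)) := by positivity
      linarith
    have hmart : RiskRL.cumulative Φ D ≤
        RiskRL.cumulative RiskRL.invSqrtVisits D + H * Real.sqrt (2 * K * ι) := by
      by_contra hgt
      rw [not_le] at hgt
      rw [← Real.exp_add, hlH] at hlt
      have h1 : H * Real.sqrt (2 * K * ι) ≤
          RiskRL.cumulative Φ D - RiskRL.cumulative RiskRL.invSqrtVisits D := by linarith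
      have h2 := mul_le_mul_of_nonneg_left h1 (show 0 ≤ l by positivity)
      have h3 : l * (H * Real.sqrt (2 * K * ι)) = 2 * ι := by
        have : l * (H * Real.sqrt (2 * K * ι)) = Real.sqrt (2 * K * ι) ^ 2 / K := by
          rw [hl]; field_simp
        rw [this, hr2]
        field_simp
      have h4 := Real.one_le_exp (show 0 ≤ -ι + (l * (RiskRL.cumulative Φ D -
        RiskRL.cumulative RiskRL.invSqrtVisits D) - ι) by linarith)
      linarith
    have hb := abs_pos.2 hβ
    have hcoef := RiskRL.div_le_mul_expFactor hb hH
    set lam := RiskRL.expFactor (|β| * (H : ℝ) ^ 2) with hlam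
    have hlam0 : 0 ≤ lam := by
      rw [hlam, RiskRL.expFactor]
      refine div_nonneg (sub_nonneg.2 (Real.one_le_exp ?_)) ?_ <;> positivity
    have hreg' : RiskRL.regret M β D ≤
        H * lam * (4 * x) * RiskRL.cumulative Φ D := by
      rw [RiskRL.regret, RiskRL.cumulative, Finset.mul_sum]
      refine Finset.sum_le_sum fun k _ => ?_
      have hΦ0 : 0 ≤ Φ k (RiskRL.past D k.2.le) (D k) :=
        RiskRL.expect_nonneg _ fun _ => RiskRL.invSqrtVisits_nonneg _ _ _
      refine (RiskRL.optValue_sub_value_le hβ (by norm_num : (0 : ℝ) ≤ 3) δ K hx hx1 (hconc k)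
        (hρ.isGreedy_past hD k) ((D k).2 0)).trans ?_
      exact mul_le_mul_of_nonneg_right (mul_le_mul_of_nonneg_right hcoef (by linarith)) hΦ0
    have hpig := RiskRL.cumulative_invSqrtVisits_le D
    have hfin := RiskRL.sqrt_mul_add_le hn' hm' (by linarith : (0 : ℝ) ≤ K) hι2
      (by linarith : (0 : ℝ) ≤ H)
    change RiskRL.regret M β D ≤ _
    calc RiskRL.regret M β D ≤ H * lam * (4 * x) * RiskRL.cumulative Φ D := hreg'
      _ ≤ H * lam * (4 * x) * (2 * H * Real.sqrt (Fintype.card S * Fintype.card A * K) +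
          H * Real.sqrt (2 * K * ι)) := by
          refine mul_le_mul_of_nonneg_left (by linarith) (by positivity)
      _ = 12 * lam * (H * Real.sqrt (Fintype.card S * ι) *
          (2 * H * Real.sqrt (Fintype.card S * Fintype.card A * K) +
            H * Real.sqrt (2 * K * ι))) := by
          rw [hx]; ring
      _ ≤ 12 * lam * (6 * Real.sqrt ((H : ℝ) ^ 3 * (Fintype.card S : ℝ) ^ 2 *
          (Fintype.card A : ℝ) * (K * H : ℝ) * ι ^ 2)) :=
          mul_le_mul_of_nonneg_left hfin (by positivity)
      _ = _ := by ring
  · rw [RiskRL.expect_add, RiskRL.expect_const_mul]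
    have h1 := RiskRL.expect_concentrationWeight_le M ρ x K
    have h2 := mul_le_mul_of_nonneg_left (RiskRL.expect_exp_cumulative_sub_le_one M ρ
      RiskRL.invSqrtVisits (by linarith : (0 : ℝ) < H) RiskRL.invSqrtVisits_nonneg
      RiskRL.invSqrtVisits_le l K) (Real.exp_pos (-ι)).le
    linarith
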